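/- Let $k$ be a field and let $A$, $B$ be multiplier Hopf algebras over $k$: associative algebras with non-degenerate product and a homomorphism $\Delta:A\to M(A\otimes A)$ such that $T_1(x\otimes y)=\Delta(x)(1\otimes y)$ and $T_2(x\otimes y)=(x\otimes 1)\Delta(y)$ define bijections of $A\otimes A$ with $(T_2\otimes \mathrm{id})(\mathrm{id}\otimes T_1)=(\mathrm{id}\otimes T_1)(T_2\otimes\mathrm{id})$. Let $\varepsilon_A,\varepsilon_B$ be their counits, and assume that they have antipodes $S_A:A\to A$, $S_B:B\to B$. Let $R:B\otimes A\to A\otimes B$, $R(b\otimes a)=a_R\otimes b_R=a_r\otimes b_r$, and $T:A\otimes B\to A\otimes B$, $T(a\otimes b)=a_T\otimes b_T=a_t\otimes b_t$, be bijective linear maps such that for all $a,c\in A$, $b,d\in B$ - $a_R\otimes (bd)_R=a_{Rr}\otimes b_rd_R$, $\quad (ac)_R\otimes b_R=a_Rc_r\otimes b_{Rr}$, - $a_T\otimes (bd)_T=a_{Tt}\otimes b_Td_t$, $\quad (ac)_T\otimes b_T=a_Tc_t\otimes b_{tT}$, - $a_T\otimes c_R\otimes d_{TR}=a_T\otimes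 c_R\otimes d_{RT}$ (i.e. $R_{23}T_{12}=T_{13}R_{23}$ on $A\otimes B\otimes A$), and $c_{RT}\otimes b_R\otimes d_T=c_{TR}\otimes b_R\otimes d_T$ (i.e. $T_{13}R_{12}=R_{12}T_{23}$ on $B\otimes A\otimes B$). Let $A\#_{RT}B$ be the space $A\otimes B$ with the product $(a\# b)(c\# d)=a_Tc_R\# b_Rd_T$. Put $\tau(a\otimes b)=b\otimes a$, $\Delta_{RT}=(\mathrm{id}\otimes\tau\otimes\mathrm{id})(\Delta_A\otimes\Delta_B)$, so that formally $\Delta_{RT}(a\# x)=\sum (a_1\# x_1)\otimes(a_2\# x_2)$, and $\varepsilon_{RT}=\varepsilon_A\otimes\varepsilon_B$, $S_{RT}=T\circ R\circ(S_B\otimes S_A)\circ\tau$. Let $$(T*R)(b\otimes y\otimes a\otimes x)=T(R(y\otimes b))\,(a\# x),\qquad (R*T)(a\otimes x\otimes b\otimes y)=(a\# x)\,T(R(y\otimes b)),$$ where the products are those of $A\#_{RT}B$. Suppose that for $w\in A\otimes B$, $(T*R)(w\otimes v)=0$ for all $v\in A\otimes B$ implies $w=0$, and $(R*T)(v\otimes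 w)=0$ for all $v\in A\otimes B$ implies $w=0$. For $M\in M(A\otimes A)$, $N\in M(B\otimes B)$ let $M\#(1\otimes 1)$ and $(1\otimes1)\# N$ be the pairs of left and right multiplication maps on $(A\#_{RT}B)\otimes(A\#_{RT}B)$ given in each leg by $(m\#1)\,T(c\otimes d)=T(mc\otimes d)$, $R(b\otimes a)\,(m\#1)=R(b\otimes am)$ and $(1\# n)\,R(d\otimes c)=R(nd\otimes c)$, $T(a\otimes b)\,(1\# n)=T(a\otimes bn)$. Suppose further that for all $a\in A$, $x\in B$ (for the last two with the usual coverings, by $1\otimes v$ from the right, respectively by $v\otimes 1$ from the left) - $\Delta_{RT}(R(x\otimes a))=((1\otimes1)\#\Delta_B(x))(\Delta_A(a)\#(1\otimes 1))$, - $\Delta_{RT}(T(a\otimes x))=(T\otimes T)\Delta_{RT}(a\# x)$, the right-hand side being the multiplier $(\Delta_A(a)\#(1\otimes1))((1\otimes1)\#\Delta_B(x))$, - $(T*R)\circ(S_A\otimes S_B\otimes\mathrm{id}_{A\otimes B})\circ\Delta_{RT}=(1\#1)\,\varepsilon_{RT}$, - $(R*T)\circ(\mathrm{id}_{A\otimes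 B}\otimes S_A\otimes S_B)\circ\Delta_{RT}=(1\#1)\,\varepsilon_{RT}$. Let $\psi_A$, $\psi_B$ be right integrals on $A$, $B$, i.e. non-zero functionals with $(\psi_A\otimes\mathrm{id})\Delta_A(a)=\psi_A(a)1$ for all $a\in A$, and likewise for $B$. Then $A\#_{RT}B$ is a multiplier Hopf algebra with comultiplication $\Delta_{RT}$, counit $\varepsilon_{RT}$ and antipode $S_{RT}$, and $\psi_A\otimes\psi_B$ is a right integral on it. -/

import Mathlib

open scoped TensorProduct

universe u v w

noncomputable section

/-! ### Multipliers and multiplier Hopf algebras -/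

section MultiplierHopf

variable (k : Type u) (A : Type v) [Field k] [NonUnitalNonAssocRing A] [Module k A]
  [IsScalarTower k A A] [SMulCommClass k A A]

/-- The multiplier algebra `M(A)`: pairs `(m₁, m₂)` of linear endomorphisms of `A` such that
`m₂(a) b = a m₁(b)`. One thinks of `m₁(a) = m a` and `m₂(a) = a m`; hence the second components
are multiplied in the opposite order. -/
def multiplierAlgebra : Subalgebra k (Module.End k A × (Module.End k A)ᵐᵒᵖ) where
  carrier := {m | ∀ a b : A, m.2.unop a * b = a * m.1 b}
  mul_mem' := by
    intro m n hm hn a b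
    have h1 := hn (m.2.unop a) b
    have h2 := hm a (n.1 b)
    simpa using h1.trans h2
  add_mem' := by
    intro m n hm hn a b
    have h1 := hm a b
    have h2 := hn a b
    simp [add_mul, mul_add, h1, h2]
  algebraMap_mem' := by
    intro r a b
    simp [Prod.algebraMap_apply, MulOpposite.algebraMap_apply, Module.algebraMap_end_apply,
      smul_mul_assoc, mul_smul_comm]

/-- Multipliers of `A`. -/
abbrev Multiplier : Type v := multiplierAlgebra k A

variable {k A}

/-- `a ↦ m a`. -/
def Multiplier.lmul (m : Multiplier k A) : A →ₗ[k] A := m.1.1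

/-- `a ↦ a m`. -/
def Multiplier.rmul (m : Multiplier k A) : A →ₗ[k] A := m.1.2.unop

variable (k A)

/-- The structure of a multiplier Hopf algebra on `A`: the product of `A` is associative and
non-degenerate, and `A` carries a homomorphism `Δ : A → M(A ⊗ A)` such that
`T₁(x ⊗ y) = Δ(x)(1 ⊗ y)` and `T₂(x ⊗ y) = (x ⊗ 1)Δ(y)` lie in `A ⊗ A`,
`(T₂ ⊗ id)(id ⊗ T₁) = (id ⊗ T₁)(T₂ ⊗ id)`, and `T₁`, `T₂` are bijective on `A ⊗ A`.
(`T₁` and `T₂` are determined by `Δ`.) -/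
structure MultiplierHopfAlgebra where
  assoc : ∀ a b c : A, a * b * c = a * (b * c)
  nondegenerate_left : ∀ a : A, (∀ b, a * b = 0) → a = 0
  nondegenerate_right : ∀ b : A, (∀ a, a * b = 0) → b = 0
  /-- the comultiplication -/
  comul : A →ₙₐ[k] Multiplier k (A ⊗[k] A)
  /-- the first canonical map -/
  T₁ : (A ⊗[k] A) ≃ₗ[k] (A ⊗[k] A)
  /-- the second canonical map -/
  T₂ : (A ⊗[k] A) ≃ₗ[k] (A ⊗[k] A)
  T₁_spec : ∀ (x y : A) (u : A ⊗[k] A),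
    (comul x).lmul ((LinearMap.mulLeft k y).lTensor A u) = T₁ (x ⊗ₜ y) * u
  T₂_spec : ∀ (x y : A) (u : A ⊗[k] A),
    (comul y).rmul ((LinearMap.mulRight k x).rTensor A u) = u * T₂ (x ⊗ₜ y)
  coassoc : ∀ (x y z : A),
    T₂.toLinearMap.rTensor A
        ((TensorProduct.assoc k A A A).symm (T₁.toLinearMap.lTensor A (x ⊗ₜ (y ⊗ₜ z)))) =
      (TensorProduct.assoc k A A A).symm (T₁.toLinearMap.lTensor A
        (TensorProduct.assoc k A A A (T₂.toLinearMap.rTensor A ((x ⊗ₜ y) ⊗ₜ z))))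

variable {k A}

namespace MultiplierHopfAlgebra

variable (H : MultiplierHopfAlgebra k A)

/-- `ε` is the counit: `(ε ⊗ id)(Δ(a)(1 ⊗ b)) = ab` and `(id ⊗ ε)((a ⊗ 1)Δ(b)) = ab`. -/
structure IsCounit (ε : A →ₗ[k] k) : Prop where
  left : ∀ a b : A, TensorProduct.lid k A (ε.rTensor A (H.T₁ (a ⊗ₜ b))) = a * b
  right : ∀ a b : A, TensorProduct.rid k A (ε.lTensor A (H.T₂ (a ⊗ₜ b))) = a * b

/-- `S : A → A` is the antipode, with respect to the counit `ε`:
`m(S ⊗ id)(Δ(a)(1 ⊗ b)) = ε(a)b` and `m(id ⊗ S)((a ⊗ 1)Δ(b)) = ε(b)a`. -/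
structure IsAntipode (ε : A →ₗ[k] k) (S : A →ₗ[k] A) : Prop where
  left : ∀ a b : A, LinearMap.mul' k A (S.rTensor A (H.T₁ (a ⊗ₜ b))) = ε a • b
  right : ∀ a b : A, LinearMap.mul' k A (S.lTensor A (H.T₂ (a ⊗ₜ b))) = ε b • a

/-- `ψ` is a right integral: a non-zero functional with `(ψ ⊗ id)Δ(a) = ψ(a)1` in `M(A)`, that is,
`(ψ ⊗ id)(Δ(a)(1 ⊗ b)) = ψ(a)b` for all `a`, `b`. -/
structure IsRightIntegral (ψ : A →ₗ[k] k) : Prop where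
  ne_zero : ψ ≠ 0
  invariant : ∀ a b : A, TensorProduct.lid k A (ψ.rTensor A (H.T₁ (a ⊗ₜ b))) = ψ a • b

end MultiplierHopfAlgebra

end MultiplierHopf

/-! ### Twisting maps and the L-R-twisted tensor product -/

section Twisted

variable {k : Type u} {A : Type v} {B : Type w} [Field k]
  [NonUnitalRing A] [Module k A] [IsScalarTower k A A] [SMulCommClass k A A]
  [NonUnitalRing B] [Module k B] [IsScalarTower k B B] [SMulCommClass k B B]

open TensorProduct (assoc rightComm tensorTensorTensorComm)

/-- `T` acting on the first and third factors of `A ⊗ X ⊗ B`. -/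
def leg13 (X : Type*) [AddCommGroup X] [Module k X] (T : (A ⊗[k] B) ≃ₗ[k] (A ⊗[k] B)) :
    ((A ⊗[k] X) ⊗[k] B) →ₗ[k] ((A ⊗[k] X) ⊗[k] B) :=
  (rightComm k A B X).toLinearMap ∘ₗ T.toLinearMap.rTensor X ∘ₗ (rightComm k A X B).toLinearMap

/-- The compatibility conditions of the twisting maps `R(b ⊗ a) = a_R ⊗ b_R` and
`T(a ⊗ b) = a_T ⊗ b_T` with the products of `A` and `B` and with each other. -/
structure IsTwistingPair (R : (B ⊗[k] A) ≃ₗ[k] (A ⊗[k] B)) (T : (A ⊗[k] B) ≃ₗ[k] (A ⊗[k] B)) :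
    Prop where
  /-- `R(m_B ⊗ id) = (id ⊗ m_B) R₁₂ R₂₃` on `B ⊗ B ⊗ A` -/
  R_mul_left : R.toLinearMap ∘ₗ (LinearMap.mul' k B).rTensor A =
    (LinearMap.mul' k B).lTensor A ∘ₗ (assoc k A B B).toLinearMap ∘ₗ R.toLinearMap.rTensor B ∘ₗ
      (assoc k B A B).symm.toLinearMap ∘ₗ R.toLinearMap.lTensor B ∘ₗ (assoc k B B A).toLinearMap
  /-- `R(id ⊗ m_A) = (m_A ⊗ id) R₂₃ R₁₂` on `B ⊗ A ⊗ A` -/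
  R_mul_right : R.toLinearMap ∘ₗ (LinearMap.mul' k A).lTensor B =
    (LinearMap.mul' k A).rTensor B ∘ₗ (assoc k A A B).symm.toLinearMap ∘ₗ
      R.toLinearMap.lTensor A ∘ₗ (assoc k A B A).toLinearMap ∘ₗ R.toLinearMap.rTensor A ∘ₗ
      (assoc k B A A).symm.toLinearMap
  /-- `T(id ⊗ m_B) = (id ⊗ m_B) T₁₃ T₁₂` on `A ⊗ B ⊗ B` -/
  T_mul_right : T.toLinearMap ∘ₗ (LinearMap.mul' k B).lTensor A ∘ₗ (assoc k A B B).toLinearMap =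
    (LinearMap.mul' k B).lTensor A ∘ₗ (assoc k A B B).toLinearMap ∘ₗ leg13 B T ∘ₗ
      T.toLinearMap.rTensor B
  /-- `T(m_A ⊗ id) = (m_A ⊗ id) T₁₃ T₂₃` on `A ⊗ A ⊗ B` -/
  T_mul_left : T.toLinearMap ∘ₗ (LinearMap.mul' k A).rTensor B =
    (LinearMap.mul' k A).rTensor B ∘ₗ leg13 A T ∘ₗ (assoc k A A B).symm.toLinearMap ∘ₗ
      T.toLinearMap.lTensor A ∘ₗ (assoc k A A B).toLinearMap
  /-- `R₂₃ T₁₂ = T₁₃ R₂₃` on `A ⊗ B ⊗ A`, i.e. `a_T ⊗ c_R ⊗ d_{TR} = a_T ⊗ c_R ⊗ d_{RT}` -/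
  comm_left : (assoc k A A B).symm.toLinearMap ∘ₗ R.toLinearMap.lTensor A ∘ₗ
      (assoc k A B A).toLinearMap ∘ₗ T.toLinearMap.rTensor A =
    leg13 A T ∘ₗ (assoc k A A B).symm.toLinearMap ∘ₗ R.toLinearMap.lTensor A ∘ₗ
      (assoc k A B A).toLinearMap
  /-- `T₁₃ R₁₂ = R₁₂ T₂₃` on `B ⊗ A ⊗ B`, i.e. `c_{RT} ⊗ b_R ⊗ d_T = c_{TR} ⊗ b_R ⊗ d_T` -/
  comm_right : leg13 B T ∘ₗ R.toLinearMap.rTensor B =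
    R.toLinearMap.rTensor B ∘ₗ (assoc k B A B).symm.toLinearMap ∘ₗ T.toLinearMap.lTensor B ∘ₗ
      (assoc k B A B).toLinearMap

/-- The underlying space `A ⊗ B` of the generalized L-R-twisted tensor product `A #_{RT} B`. It is a
type of its own because it carries another product than `A ⊗[k] B`. -/
@[nolint unusedArguments]
def LRTwisted (_R : (B ⊗[k] A) ≃ₗ[k] (A ⊗[k] B)) (_T : (A ⊗[k] B) ≃ₗ[k] (A ⊗[k] B)) :
    Type (max v w) := A ⊗[k] B

/-- `(s ⊗ t, e ⊗ f) ↦ se ⊗ ft`. -/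
def sandwich : (A ⊗[k] B) →ₗ[k] (A ⊗[k] B) →ₗ[k] (A ⊗[k] B) :=
  TensorProduct.map₂ (LinearMap.mul k A) (LinearMap.mul k B).flip

variable (R : (B ⊗[k] A) ≃ₗ[k] (A ⊗[k] B)) (T : (A ⊗[k] B) ≃ₗ[k] (A ⊗[k] B))

namespace LRTwisted

instance : AddCommGroup (LRTwisted R T) := inferInstanceAs (AddCommGroup (A ⊗[k] B))

instance : Module k (LRTwisted R T) := inferInstanceAs (Module k (A ⊗[k] B))

/-- The identification of the space `A ⊗ B` with `A #_{RT} B`. -/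
def of : (A ⊗[k] B) ≃ₗ[k] LRTwisted R T := LinearEquiv.refl k (A ⊗[k] B)

/-- The product `(a # b)(c # d) = a_T c_R # b_R d_T`, with `T(a ⊗ d) = a_T ⊗ d_T` and
`R(b ⊗ c) = c_R ⊗ b_R`, as a linear map. -/
def mulMap : (LRTwisted R T ⊗[k] LRTwisted R T) →ₗ[k] LRTwisted R T :=
  (of R T).toLinearMap ∘ₗ TensorProduct.lift sandwich ∘ₗ
    TensorProduct.map T.toLinearMap R.toLinearMap ∘ₗ
    (tensorTensorTensorComm k A B B A).toLinearMap ∘ₗ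
    TensorProduct.map (of R T).symm.toLinearMap
      ((TensorProduct.comm k A B).toLinearMap ∘ₗ (of R T).symm.toLinearMap)

instance : NonUnitalNonAssocRing (LRTwisted R T) where
  mul p q := mulMap R T (p ⊗ₜ q)
  left_distrib p q r := by
    change mulMap R T _ = mulMap R T _ + mulMap R T _
    rw [TensorProduct.tmul_add, map_add]
  right_distrib p q r := by
    change mulMap R T _ = mulMap R T _ + mulMap R T _
    rw [TensorProduct.add_tmul, map_add]
  zero_mul p := by
    change mulMap R T _ = 0
    rw [TensorProduct.zero_tmul, map_zero]
  mul_zero p := by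
    change mulMap R T _ = 0
    rw [TensorProduct.tmul_zero, map_zero]

instance : IsScalarTower k (LRTwisted R T) (LRTwisted R T) where
  smul_assoc c p q := by
    change mulMap R T ((c • p) ⊗ₜ q) = c • mulMap R T (p ⊗ₜ q)
    rw [← map_smul, TensorProduct.smul_tmul']

instance : SMulCommClass k (LRTwisted R T) (LRTwisted R T) where
  smul_comm c p q := by
    change c • mulMap R T (p ⊗ₜ q) = mulMap R T (p ⊗ₜ (c • q))
    rw [← map_smul, TensorProduct.tmul_smul]

theorem of_tmul_mul_of_tmul (a c : A) (b d : B) :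
    of R T (a ⊗ₜ b) * of R T (c ⊗ₜ d) = of R T (sandwich (T (a ⊗ₜ d)) (R (b ⊗ₜ c))) := rfl

end LRTwisted

open LRTwisted (of)

/-- `a ⊗ x ↦ T(R(x ⊗ a))` on `A ⊗ B`. -/
def flipTR : LRTwisted R T →ₗ[k] LRTwisted R T :=
  (of R T).toLinearMap ∘ₗ T.toLinearMap ∘ₗ R.toLinearMap ∘ₗ
    (TensorProduct.comm k A B).toLinearMap ∘ₗ (of R T).symm.toLinearMap

/-- The map `T * R`, `(T * R)(b ⊗ y ⊗ a ⊗ x) = (b_T a)_R ⊗ (y_R x)_T`. The compatibility conditions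
turn the right-hand side into `b_{RTt} a_r ⊗ y_{RTr} x_t`, where first `T ∘ R` is applied to
`y ⊗ b`, then `R` to the pair with `a` and `T` to the pair with `x`; this is the product
`T(R(y ⊗ b)) (a # x)` of `A #_{RT} B`, which serves as the definition. -/
def starTR : (LRTwisted R T ⊗[k] LRTwisted R T) →ₗ[k] LRTwisted R T :=
  LRTwisted.mulMap R T ∘ₗ (flipTR R T).rTensor (LRTwisted R T)

/-- The map `R * T`, `(R * T)(a ⊗ x ⊗ b ⊗ y) = (a b_R)_T ⊗ (x y_T)_R`. In the same way as for
`starTR` this is the product `(a # x) T(R(y ⊗ b))` of `A #_{RT} B`. -/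
def starRT : (LRTwisted R T ⊗[k] LRTwisted R T) →ₗ[k] LRTwisted R T :=
  LRTwisted.mulMap R T ∘ₗ (flipTR R T).lTensor (LRTwisted R T)

/-! ### Multipliers of `(A #_{RT} B) ⊗ (A #_{RT} B)` -/

/-- Pairs of linear endomorphisms of `(A #_{RT} B) ⊗ (A #_{RT} B)` (left and right multiplication),
with the product of multipliers. -/
abbrev PreMultiplier : Type _ :=
  Module.End k (LRTwisted R T ⊗[k] LRTwisted R T) ×
    (Module.End k (LRTwisted R T ⊗[k] LRTwisted R T))ᵐᵒᵖ

/-- The space `(A ⊗ A) ⊗ (B ⊗ B)` identified with `(A #_{RT} B) ⊗ (A #_{RT} B)` through the map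
`(a ⊗ b) ⊗ (x ⊗ y) ↦ T(a ⊗ x) ⊗ T(b ⊗ y)`. -/
def frameT : ((A ⊗[k] A) ⊗[k] (B ⊗[k] B)) ≃ₗ[k] (LRTwisted R T ⊗[k] LRTwisted R T) :=
  tensorTensorTensorComm k A A B B ≪≫ₗ
    TensorProduct.congr (T ≪≫ₗ of R T) (T ≪≫ₗ of R T)

/-- The space `(B ⊗ B) ⊗ (A ⊗ A)` identified with `(A #_{RT} B) ⊗ (A #_{RT} B)` through the map
`(x ⊗ y) ⊗ (a ⊗ b) ↦ R(x ⊗ a) ⊗ R(y ⊗ b)`. -/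
def frameR : ((B ⊗[k] B) ⊗[k] (A ⊗[k] A)) ≃ₗ[k] (LRTwisted R T ⊗[k] LRTwisted R T) :=
  tensorTensorTensorComm k B B A A ≪≫ₗ
    TensorProduct.congr (R ≪≫ₗ of R T) (R ≪≫ₗ of R T)

/-- The multiplier `M # (1 ⊗ 1)` for `M ∈ M(A ⊗ A)`: in one leg,
`(m # 1) T(c ⊗ d) = T(mc ⊗ d)` and `R(b ⊗ a) (m # 1) = R(b ⊗ am)`. -/
def sharpOne (M : Multiplier k (A ⊗[k] A)) : PreMultiplier R T :=
  ((frameT R T).conj (M.lmul.rTensor (B ⊗[k] B)),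
    MulOpposite.op ((frameR R T).conj (M.rmul.lTensor (B ⊗[k] B))))

/-- The multiplier `(1 ⊗ 1) # N` for `N ∈ M(B ⊗ B)`: in one leg,
`(1 # n) R(d ⊗ c) = R(nd ⊗ c)` and `T(a ⊗ b) (1 # n) = T(a ⊗ bn)`. -/
def oneSharp (N : Multiplier k (B ⊗[k] B)) : PreMultiplier R T :=
  ((frameR R T).conj (N.lmul.rTensor (A ⊗[k] A)),
    MulOpposite.op ((frameT R T).conj (N.rmul.lTensor (A ⊗[k] A))))

/-! ### The structure maps of `A #_{RT} B` -/

variable (HA : MultiplierHopfAlgebra k A) (HB : MultiplierHopfAlgebra k B)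

/-- `((c ⊗ z) ⊗ 1) (id ⊗ τ ⊗ id)(Δ_A(a) ⊗ Δ_B(x))`, an element of the space
`(A ⊗ B) ⊗ (A ⊗ B)`, as a function of `a ⊗ x`. The products with `c` and `z` are those of `A`
and `B`. -/
def coverLeft (c : A) (z : B) :
    LRTwisted R T →ₗ[k] (LRTwisted R T ⊗[k] LRTwisted R T) :=
  TensorProduct.map (of R T).toLinearMap (of R T).toLinearMap ∘ₗ
    (tensorTensorTensorComm k A A B B).toLinearMap ∘ₗ
    TensorProduct.map (HA.T₂.toLinearMap ∘ₗ TensorProduct.mk k A A c)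
      (HB.T₂.toLinearMap ∘ₗ TensorProduct.mk k B B z) ∘ₗ (of R T).symm.toLinearMap

/-- `(id ⊗ τ ⊗ id)(Δ_A(a) ⊗ Δ_B(x)) (1 ⊗ (c ⊗ z))`, an element of the space
`(A ⊗ B) ⊗ (A ⊗ B)`, as a function of `a ⊗ x`. The products with `c` and `z` are those of `A`
and `B`. -/
def coverRight (c : A) (z : B) :
    LRTwisted R T →ₗ[k] (LRTwisted R T ⊗[k] LRTwisted R T) :=
  TensorProduct.map (of R T).toLinearMap (of R T).toLinearMap ∘ₗ
    (tensorTensorTensorComm k A A B B).toLinearMap ∘ₗ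
    TensorProduct.map (HA.T₁.toLinearMap ∘ₗ (TensorProduct.mk k A A).flip c)
      (HB.T₁.toLinearMap ∘ₗ (TensorProduct.mk k B B).flip z) ∘ₗ (of R T).symm.toLinearMap

/-- `c ⊗ z` acting on `A #_{RT} B` by `a ⊗ x ↦ ca ⊗ zx`, with the products of `A` and `B`. -/
def plainLeft (c : A) (z : B) : LRTwisted R T →ₗ[k] LRTwisted R T :=
  (of R T).conj (TensorProduct.map (LinearMap.mulLeft k c) (LinearMap.mulLeft k z))

/-- `c ⊗ z` acting on `A #_{RT} B` by `a ⊗ x ↦ ac ⊗ xz`, with the products of `A` and `B`. -/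
def plainRight (c : A) (z : B) : LRTwisted R T →ₗ[k] LRTwisted R T :=
  (of R T).conj (TensorProduct.map (LinearMap.mulRight k c) (LinearMap.mulRight k z))

/-- `t = Δ_{RT}(p)(1 ⊗ q)` where `Δ_{RT} = (id ⊗ τ ⊗ id)(Δ_A ⊗ Δ_B)`. For `p = a # x` this means
`t = ∑ (a₁ # x₁) ⊗ (a₂ # x₂)q`. The legs `a₁`, `x₁` are covered by multiplying them with arbitrary
`c ∈ A`, `z ∈ B` from the left; by non-degeneracy there is at most one such `t`. -/
def IsT₁ (p q : LRTwisted R T) (t : LRTwisted R T ⊗[k] LRTwisted R T) : Prop :=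
  ∀ (c : A) (z : B), (plainLeft R T c z).rTensor (LRTwisted R T) t =
    (LinearMap.mulRight k q).lTensor (LRTwisted R T) (coverLeft R T HA HB c z p)

/-- `t = (q ⊗ 1)Δ_{RT}(p)` where `Δ_{RT} = (id ⊗ τ ⊗ id)(Δ_A ⊗ Δ_B)`. For `p = a # x` this means
`t = ∑ q(a₁ # x₁) ⊗ (a₂ # x₂)`. The legs `a₂`, `x₂` are covered by multiplying them with arbitrary
`c ∈ A`, `z ∈ B` from the right; by non-degeneracy there is at most one such `t`. -/
def IsT₂ (q p : LRTwisted R T) (t : LRTwisted R T ⊗[k] LRTwisted R T) : Prop :=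
  ∀ (c : A) (z : B), (plainRight R T c z).lTensor (LRTwisted R T) t =
    (LinearMap.mulLeft k q).rTensor (LRTwisted R T) (coverRight R T HA HB c z p)

/-- `D = Δ_{RT}(p)` where `Δ_{RT} = (id ⊗ τ ⊗ id)(Δ_A ⊗ Δ_B)`: the multiplier `D` satisfies
`D(u ⊗ q) = (Δ_{RT}(p)(1 ⊗ q))(u ⊗ 1)` and `(q ⊗ u)D = (1 ⊗ u)((q ⊗ 1)Δ_{RT}(p))`. There is at most
one such `D`. -/
structure IsComulRT (p : LRTwisted R T) (D : PreMultiplier R T) : Prop where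
  left : ∀ u q : LRTwisted R T, ∃ t, IsT₁ R T HA HB p q t ∧
    D.1 (u ⊗ₜ q) = (LinearMap.mulRight k u).rTensor (LRTwisted R T) t
  right : ∀ q u : LRTwisted R T, ∃ t, IsT₂ R T HA HB q p t ∧
    D.2.unop (q ⊗ₜ u) = (LinearMap.mulLeft k u).lTensor (LRTwisted R T) t

/-- The functional `a # x ↦ f(a)g(x)`; in particular `ε_{RT} = ε_A ⊗ ε_B`. -/
def tensorFunctional (f : A →ₗ[k] k) (g : B →ₗ[k] k) : LRTwisted R T →ₗ[k] k :=
  LinearMap.mul' k k ∘ₗ TensorProduct.map f g ∘ₗ (of R T).symm.toLinearMap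

/-- `S_{RT} = T ∘ R ∘ (S_B ⊗ S_A) ∘ τ`. -/
def antipodeRT (SA : A →ₗ[k] A) (SB : B →ₗ[k] B) : LRTwisted R T →ₗ[k] LRTwisted R T :=
  (of R T).toLinearMap ∘ₗ T.toLinearMap ∘ₗ R.toLinearMap ∘ₗ TensorProduct.map SB SA ∘ₗ
    (TensorProduct.comm k A B).toLinearMap ∘ₗ (of R T).symm.toLinearMap

/-- `S_A ⊗ S_B` on the space `A ⊗ B` of `A #_{RT} B`. -/
def plainAntipode (SA : A →ₗ[k] A) (SB : B →ₗ[k] B) : LRTwisted R T →ₗ[k] LRTwisted R T :=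
  (of R T).conj (TensorProduct.map SA SB)

end Twisted

end

noncomputable section

/-! ### Separating families of linear maps on tensor products over a field. -/

section TensorSeparation

variable {k : Type*} [Field k] {V V' W : Type*} [AddCommGroup V] [Module k V]
  [AddCommGroup V'] [Module k V'] [AddCommGroup W] [Module k W]

/-! Regard `A` and `B` as multipliers of the twisted product, so that `T(a ⊗ b) = (a # 1)(1 # b)`
and `R(b ⊗ a) = (1 # b)(a # 1)`. These are two frames `ofAB`, `ofBA` of the same space. In one frame
or the other, each of the left and right multiplications `lA`, `lB`, `rA`, `rB` by `a # 1` and `1 #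
b` is plain multiplication on one factor. The twisting conditions say that every left action
commutes with every right action, and the product is a composite of such actions (`ofBA_mul`,
`mul_ofBA`). Hence it is associative. It is non-degenerate because `T * R` and `R * T` are the
product precomposed with the bijection `T ∘ R ∘ τ`.

The first canonical map sends `(a # 1)(1 # x) ⊗ q` to `(a₁ # 1)(1 # x₁) ⊗ (a₂ # 1)(1 # x₂)q`. This
is the canonical map of `B` followed by that of `A`, each transported along a frame, so it is
bijective by construction; the second one is similar. Their coassociativity is assembled from those
of `A` and `B`, since maps on disjoint legs commute (`LegCommute.combine`).

These canonical maps describe the multiplier `(Δ(a) # 1)(1 # Δ(x))`, which by hypothesis is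
`Δ_{RT}(T(a ⊗ x))`. Non-degeneracy makes covered coproducts unique, so the canonical maps really are
`Δ_{RT}(p)(1 ⊗ q)` and `(q ⊗ 1)Δ_{RT}(p)` (`isT₁_canonicalT₁`, `isT₂_canonicalT₂`). In `(a # 1)(1 #
x)(b # 1)(1 # y)` the middle is `R(x ⊗ b)`, so the hypothesis on `Δ_{RT} ∘ R` makes `Δ_{RT}`
multiplicative (`comulRT_mul`).

Multiplicativity of the counits allows the covering factors to be chosen with counit one, which
gives the counit identities. For the integral, `(a₂ # x₂)(c # d)` is rewritten so that `x₂` acts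
alone on `c # d_T`; then `ψ_B` removes `x`, and `ψ_A` removes `a`. The antipode identities are the
last two hypotheses on `Δ_{RT}`, because `m(S_{RT} ⊗ id) = (T * R)(S_A ⊗ S_B ⊗ id)`, and likewise on
the other side. -/

theorem TensorProduct.eq_zero_of_forall_lTensor_dual (t : V ⊗[k] W)
    (h : ∀ φ : W →ₗ[k] k, φ.lTensor V t = 0) : t = 0 := by
  classical
  let b := Module.Basis.ofVectorSpace k W
  apply (TensorProduct.equivFinsuppOfBasisRight (M := V) b).injective
  ext i
  have key : ∀ s : V ⊗[k] W, TensorProduct.equivFinsuppOfBasisRight (M := V) b s i =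
      TensorProduct.rid k V ((b.coord i).lTensor V s) := by
    intro s
    induction s with
    | zero => simp
    | tmul x y => simp
    | add x y hx hy => simp [hx, hy]
  simp [key, h]

/-- Slicing with a functional on `W` commutes with every `f i`, so each slice of `t` vanishes.
Applied to multiplication operators, this carries non-degeneracy over to tensor products. -/
theorem LinearMap.rTensor_jointly_injective {ι : Sort*} (f : ι → V →ₗ[k] V')
    (hf : ∀ v, (∀ i, f i v = 0) → v = 0) (t : V ⊗[k] W)
    (ht : ∀ i, (f i).rTensor W t = 0) : t = 0 := by
  refine TensorProduct.eq_zero_of_forall_lTensor_dual t fun φ => ?_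
  apply (TensorProduct.rid k V).injective
  rw [map_zero]
  refine hf _ fun i => ?_
  have : ∀ s : V ⊗[k] W, f i (TensorProduct.rid k V (φ.lTensor V s)) =
      TensorProduct.rid k V' (φ.lTensor V' ((f i).rTensor W s)) := by
    intro s
    induction s with
    | zero => simp
    | tmul x y => simp
    | add x y hx hy => simp [hx, hy]
  rw [this, ht, map_zero, map_zero]

theorem LinearMap.lTensor_jointly_injective {ι : Sort*} (f : ι → V →ₗ[k] V')
    (hf : ∀ v, (∀ i, f i v = 0) → v = 0) (t : W ⊗[k] V)
    (ht : ∀ i, (f i).lTensor W t = 0) : t = 0 := by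
  apply (TensorProduct.comm k W V).injective
  rw [map_zero]
  refine LinearMap.rTensor_jointly_injective f hf _ fun i => ?_
  have := LinearMap.congr_fun (LinearMap.rTensor_comp_comm (N := W) (f i)) t
  simpa [ht] using this

theorem LinearMap.rTensor_separates {ι : Sort*} (f : ι → V →ₗ[k] V')
    (hf : ∀ v, (∀ i, f i v = 0) → v = 0) {s t : V ⊗[k] W}
    (ht : ∀ i, (f i).rTensor W s = (f i).rTensor W t) : s = t :=
  sub_eq_zero.1 (LinearMap.rTensor_jointly_injective f hf _ fun i => by
    rw [map_sub, ht, sub_self])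

theorem LinearMap.lTensor_separates {ι : Sort*} (f : ι → V →ₗ[k] V')
    (hf : ∀ v, (∀ i, f i v = 0) → v = 0) {s t : W ⊗[k] V}
    (ht : ∀ i, (f i).lTensor W s = (f i).lTensor W t) : s = t :=
  sub_eq_zero.1 (LinearMap.lTensor_jointly_injective f hf _ fun i => by
    rw [map_sub, ht, sub_self])

end TensorSeparation

open LinearMap (mulLeft mulRight)

section TensorMul

variable {k : Type*} {X : Type*} [Field k] [NonUnitalNonAssocRing X] [Module k X]
  [IsScalarTower k X X] [SMulCommClass k X X]

theorem tensor_mul_tmul (t : X ⊗[k] X) (b c : X) :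
    t * (b ⊗ₜ c) = (mulRight k b).rTensor X ((mulRight k c).lTensor X t) := by
  induction t with
  | zero => simp
  | tmul x y => simp
  | add x y hx hy => simp [hx, hy, add_mul]

theorem tmul_mul_tensor (t : X ⊗[k] X) (b c : X) :
    (b ⊗ₜ c) * t = (mulLeft k b).rTensor X ((mulLeft k c).lTensor X t) := by
  induction t with
  | zero => simp
  | tmul x y => simp
  | add x y hx hy => simp [hx, hy, mul_add]

end TensorMul

/-! ### Consequences of the axioms: covered coproducts and multiplicativity of the counit. -/

namespace MultiplierHopfAlgebra

section Nondegenerate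

variable {k : Type u} {X : Type v} [Field k] [NonUnitalNonAssocRing X] [Module k X]
  [IsScalarTower k X X] [SMulCommClass k X X]

theorem mulRight_separates (H : MultiplierHopfAlgebra k X) (v : X)
    (h : ∀ b, mulRight k b v = 0) : v = 0 :=
  H.nondegenerate_left v h

theorem mulLeft_separates (H : MultiplierHopfAlgebra k X) (v : X)
    (h : ∀ b, mulLeft k b v = 0) : v = 0 :=
  H.nondegenerate_right v h

end Nondegenerate

variable {k : Type u} {X : Type v} [Field k] [NonUnitalRing X] [Module k X]
  [IsScalarTower k X X] [SMulCommClass k X X]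

theorem eq_of_forall_mul_tmul (H : MultiplierHopfAlgebra k X) {s t : X ⊗[k] X}
    (h : ∀ b c : X, s * (b ⊗ₜ c) = t * (b ⊗ₜ c)) :
    s = t := by
  refine LinearMap.lTensor_separates (fun c : X => mulRight k c) H.mulRight_separates fun c => ?_
  refine LinearMap.rTensor_separates (fun c : X => mulRight k c) H.mulRight_separates fun b => ?_
  rw [← tensor_mul_tmul, h, tensor_mul_tmul]

theorem eq_of_forall_tmul_mul (H : MultiplierHopfAlgebra k X) {s t : X ⊗[k] X}
    (h : ∀ b c : X, (b ⊗ₜ c) * s = (b ⊗ₜ c) * t) :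
    s = t := by
  refine LinearMap.lTensor_separates (fun c : X => mulLeft k c) H.mulLeft_separates fun c => ?_
  refine LinearMap.rTensor_separates (fun c : X => mulLeft k c) H.mulLeft_separates fun b => ?_
  rw [← tmul_mul_tensor, h, tmul_mul_tensor]

/-- Non-degeneracy forces module linearity: `p(M(st)) = (pM)(st) = (p(Ms))t` for every `p`. -/
theorem lmul_mul (H : MultiplierHopfAlgebra k X) (M : Multiplier k (X ⊗[k] X)) (s t : X ⊗[k] X) :
    M.lmul (s * t) = M.lmul s * t := by
  refine H.eq_of_forall_tmul_mul fun b c => ?_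
  have h1 : ∀ p q, M.rmul p * q = p * M.lmul q := M.2
  rw [← h1, ← mul_assoc, ← mul_assoc, h1]

theorem mul_rmul (H : MultiplierHopfAlgebra k X) (M : Multiplier k (X ⊗[k] X)) (s t : X ⊗[k] X) :
    M.rmul (s * t) = s * M.rmul t := by
  refine H.eq_of_forall_mul_tmul fun b c => ?_
  have h1 : ∀ p q, M.rmul p * q = p * M.lmul q := M.2
  rw [h1, mul_assoc, mul_assoc, h1]

/-- Recovers `Δ(x)` on simple tensors from `T₁`: `Δ(x)(y ⊗ z) = (Δ(x)(1 ⊗ z))(y ⊗ 1)`. The axiom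
gives this only after right multiplication by an element, which non-degeneracy cancels. -/
theorem lmul_comul (H : MultiplierHopfAlgebra k X) (x y z : X) :
    (H.comul x).lmul (y ⊗ₜ z) = (mulRight k y).rTensor X (H.T₁ (x ⊗ₜ z)) := by
  refine H.eq_of_forall_mul_tmul fun b c => ?_
  rw [← H.lmul_mul]
  have h := H.T₁_spec x z ((y * b) ⊗ₜ c)
  simp only [LinearMap.lTensor_tmul, LinearMap.mulLeft_apply] at h
  rw [Algebra.TensorProduct.tmul_mul_tmul, h]
  generalize H.T₁ (x ⊗ₜ z) = t
  induction t with
  | zero => simp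
  | tmul x y => simp [mul_assoc]
  | add x y hx hy => simp only [map_add, add_mul, hx, hy]

theorem rmul_comul (H : MultiplierHopfAlgebra k X) (x y z : X) :
    (H.comul x).rmul (y ⊗ₜ z) = (mulLeft k z).lTensor X (H.T₂ (y ⊗ₜ x)) := by
  refine H.eq_of_forall_tmul_mul fun b c => ?_
  rw [← H.mul_rmul]
  have h := H.T₂_spec y x (b ⊗ₜ (c * z))
  simp only [LinearMap.rTensor_tmul, LinearMap.mulRight_apply] at h
  rw [Algebra.TensorProduct.tmul_mul_tmul, h]
  generalize H.T₂ (y ⊗ₜ x) = t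
  induction t with
  | zero => simp
  | tmul x y => simp [mul_assoc]
  | add x y hx hy => simp only [map_add, mul_add, hx, hy]

/-- Both sides are `(r ⊗ 1) Δ(p) (1 ⊗ q)`. -/
theorem mulLeft_T₁ (H : MultiplierHopfAlgebra k X) (r p q : X) :
    (mulLeft k r).rTensor X (H.T₁ (p ⊗ₜ q)) = (mulRight k q).lTensor X (H.T₂ (r ⊗ₜ p)) := by
  refine LinearMap.lTensor_separates (fun c : X => mulLeft k c) H.mulLeft_separates fun c => ?_
  refine LinearMap.rTensor_separates (fun c : X => mulRight k c) H.mulRight_separates fun b => ?_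
  have h : (H.comul p).rmul (r ⊗ₜ c) * (b ⊗ₜ q) = (r ⊗ₜ c) * (H.comul p).lmul (b ⊗ₜ q) :=
    (H.comul p).2 _ _
  rw [H.rmul_comul, H.lmul_comul, tensor_mul_tmul, tmul_mul_tensor] at h
  have h1 : ∀ s : X ⊗[k] X, (mulRight k b).rTensor X ((mulLeft k c).lTensor X
      ((mulLeft k r).rTensor X s)) =
      (mulLeft k r).rTensor X ((mulLeft k c).lTensor X ((mulRight k b).rTensor X s)) := by
    intro s
    induction s with
    | zero => simp
    | tmul x y => simp [mul_assoc]
    | add x y hx hy => simp only [map_add, hx, hy]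
  have h2 : ∀ s : X ⊗[k] X, (mulRight k b).rTensor X ((mulLeft k c).lTensor X
      ((mulRight k q).lTensor X s)) =
      (mulRight k b).rTensor X ((mulRight k q).lTensor X ((mulLeft k c).lTensor X s)) := by
    intro s
    induction s with
    | zero => simp
    | tmul x y => simp [mul_assoc]
    | add x y hx hy => simp only [map_add, hx, hy]
  rw [h1, h2, h]

variable {H : MultiplierHopfAlgebra k X}

/-- Surjectivity of `T₁` is used twice. Writing `b ⊗ c` as a value of `T₁` gives `(ε ⊗ id)(Δ(a)(b ⊗
c)) = ε(b)ac`. Writing an arbitrary tensor `t` as a value of `T₁` then gives `(ε ⊗ id)(t(b ⊗ 1)) =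
ε(b)(ε ⊗ id)(t)`, and `t = a ⊗ c` with `c ≠ 0` finishes. -/
theorem IsCounit.apply_mul {ε : X →ₗ[k] k} (hε : H.IsCounit ε) (a b : X) :
    ε (a * b) = ε a * ε b := by
  have h1 : ∀ a b c : X, TensorProduct.lid k X (ε.rTensor X ((H.comul a).lmul (b ⊗ₜ c))) =
      ε b • (a * c) := by
    intro a b c
    have key : ∀ t : X ⊗[k] X, TensorProduct.lid k X (ε.rTensor X ((H.comul a).lmul (H.T₁ t))) =
        a * TensorProduct.lid k X (ε.rTensor X (H.T₁ t)) := by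
      intro t
      induction t with
      | zero => simp
      | tmul x y =>
        rw [hε.left, ← mul_assoc, ← hε.left]
        congr 2
        -- What remains is `Δ(a) T₁(x ⊗ y) = T₁(ax ⊗ y)`, a form of the multiplicativity of `Δ`.
        refine H.eq_of_forall_mul_tmul fun b c => ?_
        rw [← H.lmul_mul, ← H.T₁_spec, ← H.T₁_spec, map_mul]
        rfl
      | add x y hx hy => simp only [map_add, mul_add, hx, hy]
    obtain ⟨t, ht⟩ := H.T₁.surjective (b ⊗ₜ c)
    rw [← ht, key, ht]
    simp [mul_smul_comm]
  have h2 : ∀ (b : X) (t : X ⊗[k] X), TensorProduct.lid k X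
      (ε.rTensor X ((mulRight k b).rTensor X t)) =
        ε b • TensorProduct.lid k X (ε.rTensor X t) := by
    intro b t
    obtain ⟨t, rfl⟩ := H.T₁.surjective t
    induction t with
    | zero => simp
    | tmul x y => rw [← H.lmul_comul, h1, hε.left]
    | add x y hx hy => simp only [map_add, smul_add, hx, hy]
  rcases subsingleton_or_nontrivial X with hX | hX
  · simp [Subsingleton.elim a 0]
  obtain ⟨c, hc⟩ := exists_ne (0 : X)
  have := h2 b (a ⊗ₜ c)
  simp only [LinearMap.rTensor_tmul, LinearMap.mulRight_apply, TensorProduct.lid_tmul,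
    smul_smul] at this
  rw [smul_left_injective k hc this, mul_comm]

/-- Here `ε` hits the covered leg, which the counit axioms do not address directly. Apply `ε ⊗ id`
to `(a ⊗ 1)Δ(b)(1 ⊗ c)`, pull out `ε(a)` by multiplicativity, and cancel `c`. -/
theorem IsCounit.rTensor_T₂ {ε : X →ₗ[k] k} (hε : H.IsCounit ε) (a b : X) :
    TensorProduct.lid k X (ε.rTensor X (H.T₂ (a ⊗ₜ b))) = ε a • b := by
  refine sub_eq_zero.1 (H.nondegenerate_left _ fun c => ?_)
  rw [sub_mul, sub_eq_zero]
  have h := congrArg (fun t => TensorProduct.lid k X (ε.rTensor X t)) (H.mulLeft_T₁ a b c)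
  have h1 : ∀ t : X ⊗[k] X, TensorProduct.lid k X (ε.rTensor X ((mulLeft k a).rTensor X t)) =
      ε a • TensorProduct.lid k X (ε.rTensor X t) := by
    intro t
    induction t with
    | zero => simp
    | tmul x y => simp [hε.apply_mul, mul_smul]
    | add x y hx hy => simp only [map_add, smul_add, hx, hy]
  have h2 : ∀ t : X ⊗[k] X, TensorProduct.lid k X (ε.rTensor X ((mulRight k c).lTensor X t)) =
      TensorProduct.lid k X (ε.rTensor X t) * c := by
    intro t
    induction t with
    | zero => simp
    | tmul x y => simp [smul_mul_assoc]
    | add x y hx hy => simp only [map_add, add_mul, hx, hy]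
  simp only [h1, h2, hε.left] at h
  rw [← h, smul_mul_assoc]

theorem IsCounit.lTensor_T₁ {ε : X →ₗ[k] k} (hε : H.IsCounit ε) (a b : X) :
    TensorProduct.rid k X (ε.lTensor X (H.T₁ (a ⊗ₜ b))) = ε b • a := by
  refine sub_eq_zero.1 (H.nondegenerate_right _ fun c => ?_)
  rw [mul_sub, sub_eq_zero]
  have h := congrArg (fun t => TensorProduct.rid k X (ε.lTensor X t)) (H.mulLeft_T₁ c a b)
  have h1 : ∀ t : X ⊗[k] X, TensorProduct.rid k X (ε.lTensor X ((mulRight k b).lTensor X t)) =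
      ε b • TensorProduct.rid k X (ε.lTensor X t) := by
    intro t
    induction t with
    | zero => simp
    | tmul x y => simp [hε.apply_mul, mul_smul, smul_comm (ε b)]
    | add x y hx hy => simp only [map_add, smul_add, hx, hy]
  have h2 : ∀ t : X ⊗[k] X, TensorProduct.rid k X (ε.lTensor X ((mulLeft k c).rTensor X t)) =
      c * TensorProduct.rid k X (ε.lTensor X t) := by
    intro t
    induction t with
    | zero => simp
    | tmul x y => simp [mul_smul_comm]
    | add x y hx hy => simp only [map_add, mul_add, hx, hy]
  simp only [h1, h2, hε.right] at h
  rw [h, mul_smul_comm]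

/-- If `ε` vanished, the counit identity would make every product in `X` zero. -/
theorem IsCounit.exists_eq_one [Nontrivial X] {ε : X →ₗ[k] k} (hε : H.IsCounit ε) :
    ∃ a, ε a = 1 := by
  by_contra hne
  have h0 : ∀ a, ε a = 0 := by
    intro a
    by_contra ha
    exact hne ⟨(ε a)⁻¹ • a, by simp [ha]⟩
  obtain ⟨c, hc⟩ := exists_ne (0 : X)
  refine hc (H.nondegenerate_left c fun b => ?_)
  have : ε = 0 := LinearMap.ext h0
  rw [← hε.left, this]
  simp

end MultiplierHopfAlgebra

/-! ### Actions and coverings transported along a frame -/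

section Frame

open TensorProduct (tensorTensorTensorComm)

variable {k : Type*} [Field k] {X Y C : Type*} [NonUnitalRing X] [Module k X]
  [IsScalarTower k X X] [SMulCommClass k X X] [AddCommGroup Y] [Module k Y]
  [AddCommGroup C] [Module k C]

/-- The left action of `X` on `C ≅ X ⊗ Y` by multiplication on the factor `X`. -/
def leftAct (F : (X ⊗[k] Y) ≃ₗ[k] C) : X →ₗ[k] Module.End k C :=
  F.conj.toLinearMap ∘ₗ LinearMap.rTensorHom Y ∘ₗ LinearMap.mul k X

/-- The right action of `X` on `C ≅ Y ⊗ X` by multiplication on the factor `X`. -/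
def rightAct (F : (Y ⊗[k] X) ≃ₗ[k] C) : X →ₗ[k] Module.End k C :=
  F.conj.toLinearMap ∘ₗ LinearMap.lTensorHom Y ∘ₗ (LinearMap.mul k X).flip

@[simp]
theorem leftAct_frame (F : (X ⊗[k] Y) ≃ₗ[k] C) (a x : X) (y : Y) :
    leftAct F a (F (x ⊗ₜ y)) = F ((a * x) ⊗ₜ y) := by
  simp [leftAct, LinearEquiv.conj_apply]

@[simp]
theorem rightAct_frame (F : (Y ⊗[k] X) ≃ₗ[k] C) (a x : X) (y : Y) :
    rightAct F a (F (y ⊗ₜ x)) = F (y ⊗ₜ (x * a)) := by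
  simp [rightAct, LinearEquiv.conj_apply]

theorem LinearEquiv.induction_tmul {X Y C : Type*} [AddCommGroup X] [Module k X]
    [AddCommGroup Y] [Module k Y] [AddCommGroup C] [Module k C]
    (F : (X ⊗[k] Y) ≃ₗ[k] C) {p : C → Prop} (h0 : p 0) (ht : ∀ x y, p (F (x ⊗ₜ y)))
    (ha : ∀ c d, p c → p d → p (c + d)) (c : C) : p c := by
  obtain ⟨t, rfl⟩ := F.surjective c
  induction t with
  | zero => rwa [map_zero]
  | tmul x y => exact ht x y
  | add x y hx hy => rw [map_add]; exact ha _ _ hx hy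

theorem rightAct_mul (F : (Y ⊗[k] X) ≃ₗ[k] C) (a b : X) (c : C) :
    rightAct F (a * b) c = rightAct F b (rightAct F a c) := by
  induction c using F.induction_tmul with
  | h0 => simp
  | ht x y => simp [mul_assoc]
  | ha x y hx hy => simp only [map_add, hx, hy]

namespace MultiplierHopfAlgebra

variable (H : MultiplierHopfAlgebra k X)

/-- `x ⊗ q ↦ x₁ ⊗ x₂ q` on `X ⊗ C`. -/
def leftCov (F : (X ⊗[k] Y) ≃ₗ[k] C) : (X ⊗[k] C) ≃ₗ[k] (X ⊗[k] C) :=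
  F.symm.lTensor X ≪≫ₗ (TensorProduct.assoc k X X Y).symm ≪≫ₗ H.T₁.rTensor Y ≪≫ₗ
    TensorProduct.assoc k X X Y ≪≫ₗ F.lTensor X

/-- `q ⊗ x ↦ q x₁ ⊗ x₂` on `C ⊗ X`. -/
def rightCov (F : (Y ⊗[k] X) ≃ₗ[k] C) : (C ⊗[k] X) ≃ₗ[k] (C ⊗[k] X) :=
  F.symm.rTensor X ≪≫ₗ TensorProduct.assoc k Y X X ≪≫ₗ H.T₂.lTensor Y ≪≫ₗ
    (TensorProduct.assoc k Y X X).symm ≪≫ₗ F.rTensor X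

theorem leftCov_frame (F : (X ⊗[k] Y) ≃ₗ[k] C) (a x : X) (y : Y) :
    H.leftCov F (a ⊗ₜ F (x ⊗ₜ y)) =
      (F.toLinearMap ∘ₗ (TensorProduct.mk k X Y).flip y).lTensor X (H.T₁ (a ⊗ₜ x)) := by
  simp only [leftCov, LinearEquiv.trans_apply, LinearEquiv.lTensor_tmul,
    LinearEquiv.symm_apply_apply, TensorProduct.assoc_symm_tmul, LinearEquiv.rTensor_tmul]
  generalize H.T₁ (a ⊗ₜ x) = t
  induction t with
  | zero => simp
  | tmul s t => simp
  | add s t hs ht => simp only [TensorProduct.add_tmul, map_add, hs, ht]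

theorem rightCov_frame (F : (Y ⊗[k] X) ≃ₗ[k] C) (a x : X) (y : Y) :
    H.rightCov F (F (y ⊗ₜ x) ⊗ₜ a) =
      (F.toLinearMap ∘ₗ TensorProduct.mk k Y X y).rTensor X (H.T₂ (x ⊗ₜ a)) := by
  simp only [rightCov, LinearEquiv.trans_apply, LinearEquiv.rTensor_tmul,
    LinearEquiv.symm_apply_apply, TensorProduct.assoc_tmul, LinearEquiv.lTensor_tmul]
  generalize H.T₂ (x ⊗ₜ a) = t
  induction t with
  | zero => simp
  | tmul s t => simp
  | add s t hs ht => simp only [TensorProduct.tmul_add, map_add, hs, ht]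

/-- Both sides are `x₁ · c ⊗ x₂ · q`. With `F` one of the two frames of the twisted product, this
evaluates the left parts of `sharpOne` and `oneSharp` at a coproduct. -/
theorem conj_lmul_comul (F : (X ⊗[k] Y) ≃ₗ[k] C) (x : X) (c q : C) :
    (tensorTensorTensorComm k X X Y Y ≪≫ₗ TensorProduct.congr F F).conj
        ((H.comul x).lmul.rTensor (Y ⊗[k] Y)) (c ⊗ₜ q) =
      ((leftAct F).flip c).rTensor C (H.leftCov F (x ⊗ₜ q)) := by
  induction c using F.induction_tmul with
  | h0 => simp
  | ha s t hs ht => simp only [TensorProduct.add_tmul, map_add, hs, ht, LinearMap.rTensor_add,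
      LinearMap.add_apply]
  | ht a b =>
  induction q using F.induction_tmul with
  | h0 => simp
  | ha s t hs ht => simp only [TensorProduct.tmul_add, map_add, hs, ht]
  | ht a' b' =>
  rw [leftCov_frame]
  simp only [LinearEquiv.conj_apply, LinearMap.comp_apply, LinearEquiv.coe_coe,
    LinearEquiv.trans_symm, LinearEquiv.trans_apply, TensorProduct.congr_symm_tmul,
    LinearEquiv.symm_apply_apply, TensorProduct.tensorTensorTensorComm_symm,
    TensorProduct.tensorTensorTensorComm_tmul, LinearMap.rTensor_tmul, H.lmul_comul]
  generalize H.T₁ (x ⊗ₜ a') = t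
  induction t with
  | zero => simp
  | tmul s t => simp
  | add s t hs ht => simp only [TensorProduct.add_tmul, map_add, hs, ht]

theorem conj_rmul_comul (F : (Y ⊗[k] X) ≃ₗ[k] C) (x : X) (q c : C) :
    (tensorTensorTensorComm k Y Y X X ≪≫ₗ TensorProduct.congr F F).conj
        ((H.comul x).rmul.lTensor (Y ⊗[k] Y)) (q ⊗ₜ c) =
      ((rightAct F).flip c).lTensor C (H.rightCov F (q ⊗ₜ x)) := by
  induction c using F.induction_tmul with
  | h0 => simp
  | ha s t hs ht => simp only [TensorProduct.tmul_add, map_add, hs, ht, LinearMap.lTensor_add,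
      LinearMap.add_apply]
  | ht a b =>
  induction q using F.induction_tmul with
  | h0 => simp
  | ha s t hs ht => simp only [TensorProduct.add_tmul, map_add, hs, ht]
  | ht a' b' =>
  rw [rightCov_frame]
  simp only [LinearEquiv.conj_apply, LinearMap.comp_apply, LinearEquiv.coe_coe,
    LinearEquiv.trans_symm, LinearEquiv.trans_apply, TensorProduct.congr_symm_tmul,
    LinearEquiv.symm_apply_apply, TensorProduct.tensorTensorTensorComm_symm,
    TensorProduct.tensorTensorTensorComm_tmul, LinearMap.lTensor_tmul, H.rmul_comul]
  generalize H.T₂ (b' ⊗ₜ x) = t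
  induction t with
  | zero => simp
  | tmul s t => simp
  | add s t hs ht => simp only [TensorProduct.tmul_add, map_add, hs, ht]

/-- Both sides are `z x₁ ⊗ x₂ · q`: a coproduct covered on the left by `z` and on the right by the
action on `q`. -/
theorem mulLeft_leftCov (F : (X ⊗[k] Y) ≃ₗ[k] C) (z x : X) (q : C) :
    (mulLeft k z).rTensor C (H.leftCov F (x ⊗ₜ q)) =
      ((leftAct F).flip q).lTensor X (H.T₂ (z ⊗ₜ x)) := by
  induction q using F.induction_tmul with
  | h0 => simp
  | ha s t hs ht => simp only [TensorProduct.tmul_add, map_add, hs, ht, LinearMap.lTensor_add,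
      LinearMap.add_apply]
  | ht a b =>
  rw [leftCov_frame]
  have h1 : ∀ t : X ⊗[k] X, (mulLeft k z).rTensor C
      ((F.toLinearMap ∘ₗ (TensorProduct.mk k X Y).flip b).lTensor X t) =
      (F.toLinearMap ∘ₗ (TensorProduct.mk k X Y).flip b).lTensor X
        ((mulLeft k z).rTensor X t) := by
    intro t
    induction t with
    | zero => simp
    | tmul s t => simp
    | add s t hs ht => simp only [map_add, hs, ht]
  rw [h1, H.mulLeft_T₁]
  generalize H.T₂ (z ⊗ₜ x) = t
  induction t with
  | zero => simp
  | tmul s t => simp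
  | add s t hs ht => simp only [map_add, hs, ht]

variable {H} in
theorem IsRightIntegral.rTensor_leftCov {ψ : X →ₗ[k] k} (hψ : H.IsRightIntegral ψ)
    (F : (X ⊗[k] Y) ≃ₗ[k] C) (x : X) (q : C) :
    TensorProduct.lid k C (ψ.rTensor C (H.leftCov F (x ⊗ₜ q))) = ψ x • q := by
  induction q using F.induction_tmul with
  | h0 => simp
  | ha s t hs ht => simp only [TensorProduct.tmul_add, map_add, hs, ht, smul_add]
  | ht a b =>
  rw [leftCov_frame]
  have h1 : ∀ t : X ⊗[k] X, TensorProduct.lid k C (ψ.rTensor C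
      ((F.toLinearMap ∘ₗ (TensorProduct.mk k X Y).flip b).lTensor X t)) =
      F (TensorProduct.lid k X (ψ.rTensor X t) ⊗ₜ b) := by
    intro t
    induction t with
    | zero => simp
    | tmul s t => simp [← TensorProduct.smul_tmul']
    | add s t hs ht => simp only [map_add, hs, ht, TensorProduct.add_tmul]
  rw [h1, hψ.invariant, ← TensorProduct.smul_tmul', map_smul]

end MultiplierHopfAlgebra

end Frame

/-! ### Combining the coassociativity of two families of canonical maps. -/

section Commute

open TensorProduct (assoc rightComm leftComm tensorTensorTensorComm)

variable {k : Type*} [Field k] {X Y U V : Type*} [AddCommGroup X] [Module k X]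
  [AddCommGroup Y] [Module k Y] [AddCommGroup U] [Module k U] [AddCommGroup V] [Module k V]

/-- `f` acting on the first two and `g` acting on the last two factors of `X ⊗ U ⊗ Y` commute. -/
def LegCommute (f : (X ⊗[k] U) ≃ₗ[k] (X ⊗[k] U)) (g : (U ⊗[k] Y) ≃ₗ[k] (U ⊗[k] Y)) : Prop :=
  ∀ (r : X) (p : U) (q : Y), f.toLinearMap.rTensor Y ((assoc k X U Y).symm (r ⊗ₜ g (p ⊗ₜ q))) =
    (assoc k X U Y).symm (g.toLinearMap.lTensor X (assoc k X U Y (f (r ⊗ₜ p) ⊗ₜ q)))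

/-- `g` on the last two and then `f` on the outer two factors of `U ⊗ V ⊗ Y`. -/
def combineLeft (f : (U ⊗[k] Y) ≃ₗ[k] (U ⊗[k] Y)) (g : (V ⊗[k] Y) ≃ₗ[k] (V ⊗[k] Y)) :
    ((U ⊗[k] V) ⊗[k] Y) ≃ₗ[k] ((U ⊗[k] V) ⊗[k] Y) :=
  assoc k U V Y ≪≫ₗ g.lTensor U ≪≫ₗ leftComm k U V Y ≪≫ₗ f.lTensor V ≪≫ₗ leftComm k V U Y ≪≫ₗ
    (assoc k U V Y).symm

/-- `f` on the first two and then `g` on the outer two factors of `X ⊗ U ⊗ V`. -/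
def combineRight (f : (X ⊗[k] U) ≃ₗ[k] (X ⊗[k] U)) (g : (X ⊗[k] V) ≃ₗ[k] (X ⊗[k] V)) :
    (X ⊗[k] (U ⊗[k] V)) ≃ₗ[k] (X ⊗[k] (U ⊗[k] V)) :=
  (assoc k X U V).symm ≪≫ₗ f.rTensor V ≪≫ₗ rightComm k X U V ≪≫ₗ g.rTensor U ≪≫ₗ
    rightComm k X V U ≪≫ₗ assoc k X U V

/-- `v ⊗ y ↦ f(p ⊗ y)` with `v` inserted between the two factors. -/
def combineLeftAux (f : (U ⊗[k] Y) ≃ₗ[k] (U ⊗[k] Y)) (p : U) :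
    (V ⊗[k] Y) →ₗ[k] ((U ⊗[k] V) ⊗[k] Y) :=
  (assoc k U V Y).symm.toLinearMap ∘ₗ (leftComm k V U Y).toLinearMap ∘ₗ
    f.toLinearMap.lTensor V ∘ₗ (leftComm k U V Y).toLinearMap ∘ₗ TensorProduct.mk k U (V ⊗[k] Y) p

/-- `x ⊗ p ↦ g(x ⊗ v)` with `p` inserted between the two factors. -/
def combineRightAux (g : (X ⊗[k] V) ≃ₗ[k] (X ⊗[k] V)) (v : V) :
    (X ⊗[k] U) →ₗ[k] (X ⊗[k] (U ⊗[k] V)) :=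
  (assoc k X U V).toLinearMap ∘ₗ (rightComm k X V U).toLinearMap ∘ₗ
    g.toLinearMap.rTensor U ∘ₗ (rightComm k X U V).toLinearMap ∘ₗ
      (TensorProduct.mk k (X ⊗[k] U) V).flip v

theorem combineLeft_tmul (f : (U ⊗[k] Y) ≃ₗ[k] (U ⊗[k] Y)) (g : (V ⊗[k] Y) ≃ₗ[k] (V ⊗[k] Y))
    (p : U) (v : V) (y : Y) :
    combineLeft f g ((p ⊗ₜ v) ⊗ₜ y) = combineLeftAux f p (g (v ⊗ₜ y)) := rfl

theorem combineRight_tmul (f : (X ⊗[k] U) ≃ₗ[k] (X ⊗[k] U)) (g : (X ⊗[k] V) ≃ₗ[k] (X ⊗[k] V))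
    (x : X) (p : U) (v : V) :
    combineRight f g (x ⊗ₜ (p ⊗ₜ v)) = combineRightAux g v (f (x ⊗ₜ p)) := rfl

theorem combineLeftAux_tmul (f : (U ⊗[k] Y) ≃ₗ[k] (U ⊗[k] Y)) (p : U) (v : V) (y : Y) :
    combineLeftAux f p (v ⊗ₜ y) = ((TensorProduct.mk k U V).flip v).rTensor Y (f (p ⊗ₜ y)) := by
  simp only [combineLeftAux, LinearMap.comp_apply, TensorProduct.mk_apply, LinearEquiv.coe_coe,
    TensorProduct.leftComm_tmul, LinearMap.lTensor_tmul]
  generalize f (p ⊗ₜ y) = t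
  induction t with
  | zero => simp
  | tmul s t => simp
  | add s t hs ht => simp only [TensorProduct.tmul_add, map_add, hs, ht]

theorem combineRightAux_tmul (g : (X ⊗[k] V) ≃ₗ[k] (X ⊗[k] V)) (v : V) (x : X) (p : U) :
    combineRightAux g v (x ⊗ₜ p) = (TensorProduct.mk k U V p).lTensor X (g (x ⊗ₜ v)) := by
  simp only [combineRightAux, LinearMap.comp_apply, TensorProduct.mk_apply, LinearEquiv.coe_coe,
    TensorProduct.rightComm_tmul, LinearMap.rTensor_tmul, LinearMap.flip_apply]
  generalize g (x ⊗ₜ v) = t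
  induction t with
  | zero => simp
  | tmul s t => simp
  | add s t hs ht => simp only [TensorProduct.add_tmul, map_add, hs, ht]

/-- `g` on the factors `X ⊗ V` and `f` on the factors `U ⊗ Y`. -/
def combineCross (g : (X ⊗[k] V) ≃ₗ[k] (X ⊗[k] V)) (f : (U ⊗[k] Y) ≃ₗ[k] (U ⊗[k] Y)) :
    ((X ⊗[k] U) ⊗[k] (V ⊗[k] Y)) →ₗ[k] ((X ⊗[k] (U ⊗[k] V)) ⊗[k] Y) :=
  (assoc k X U V).toLinearMap.rTensor Y ∘ₗ (assoc k (X ⊗[k] U) V Y).symm.toLinearMap ∘ₗ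
    (tensorTensorTensorComm k X V U Y).toLinearMap ∘ₗ
    TensorProduct.map g.toLinearMap f.toLinearMap ∘ₗ (tensorTensorTensorComm k X U V Y).toLinearMap

theorem combineCross_tmul_left (g : (X ⊗[k] V) ≃ₗ[k] (X ⊗[k] V))
    (f : (U ⊗[k] Y) ≃ₗ[k] (U ⊗[k] Y)) (s : X ⊗[k] U) (v : V) (y : Y) :
    combineCross g f (s ⊗ₜ (v ⊗ₜ y)) = (combineRightAux g v).rTensor Y
      ((assoc k X U Y).symm (f.toLinearMap.lTensor X (assoc k X U Y (s ⊗ₜ y)))) := by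
  induction s with
  | zero => simp
  | add s t hs ht => simp only [TensorProduct.add_tmul, map_add, hs, ht]
  | tmul x p =>
  simp only [combineCross, LinearMap.comp_apply, LinearEquiv.coe_coe,
    TensorProduct.tensorTensorTensorComm_tmul, TensorProduct.map_tmul, TensorProduct.assoc_tmul,
    LinearMap.lTensor_tmul]
  generalize f (p ⊗ₜ y) = t
  induction t with
  | zero => simp
  | add s t hs ht => simp only [TensorProduct.tmul_add, map_add, hs, ht]
  | tmul p' y' =>
  simp only [TensorProduct.assoc_symm_tmul, LinearMap.rTensor_tmul, combineRightAux_tmul]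
  generalize g (x ⊗ₜ v) = t
  induction t with
  | zero => simp
  | add s t hs ht => simp only [TensorProduct.add_tmul, map_add, hs, ht]
  | tmul s t => simp

theorem combineCross_tmul_right (g : (X ⊗[k] V) ≃ₗ[k] (X ⊗[k] V))
    (f : (U ⊗[k] Y) ≃ₗ[k] (U ⊗[k] Y)) (x : X) (p : U) (w : V ⊗[k] Y) :
    combineCross g f ((x ⊗ₜ p) ⊗ₜ w) = (assoc k X (U ⊗[k] V) Y).symm
      ((combineLeftAux f p).lTensor X (assoc k X V Y (g.toLinearMap.rTensor Y
        ((assoc k X V Y).symm (x ⊗ₜ w))))) := by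
  induction w with
  | zero => simp
  | add s t hs ht => simp only [TensorProduct.tmul_add, map_add, hs, ht]
  | tmul v y =>
  simp only [combineCross, LinearMap.comp_apply, LinearEquiv.coe_coe,
    TensorProduct.tensorTensorTensorComm_tmul, TensorProduct.map_tmul,
    TensorProduct.assoc_symm_tmul, LinearMap.rTensor_tmul]
  generalize g (x ⊗ₜ v) = t
  induction t with
  | zero => simp
  | add s t hs ht => simp only [TensorProduct.add_tmul, map_add, hs, ht]
  | tmul x' v' =>
  simp only [TensorProduct.assoc_tmul, LinearMap.lTensor_tmul, combineLeftAux_tmul]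
  generalize f (p ⊗ₜ y) = t
  induction t with
  | zero => simp
  | add s t hs ht => simp only [TensorProduct.tmul_add, map_add, hs, ht]
  | tmul s t => simp

/-- On `X ⊗ U ⊗ V ⊗ Y` the two sides are the composites `g f f' g'` and `f' g' g f`. Swapping `f`
with `f'` in the first and `g` with `g'` in the second turns both into `(g f')(f g')`, where the
maps in each bracket act on disjoint legs. This common value is expressed by `combineCross`. -/
theorem LegCommute.combine {f : (X ⊗[k] U) ≃ₗ[k] (X ⊗[k] U)} {f' : (U ⊗[k] Y) ≃ₗ[k] (U ⊗[k] Y)}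
    {g : (X ⊗[k] V) ≃ₗ[k] (X ⊗[k] V)} {g' : (V ⊗[k] Y) ≃ₗ[k] (V ⊗[k] Y)}
    (hf : LegCommute f f') (hg : LegCommute g g') :
    LegCommute (combineRight f g) (combineLeft f' g') := by
  intro r p q
  induction p with
  | zero => simp
  | add s t hs ht =>
    simp only [TensorProduct.add_tmul, TensorProduct.tmul_add, map_add, hs, ht]
  | tmul p v =>
  trans combineCross g f' (f (r ⊗ₜ p) ⊗ₜ g' (v ⊗ₜ q))
  · rw [combineLeft_tmul]
    generalize g' (v ⊗ₜ q) = w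
    induction w with
    | zero => simp
    | add s t hs ht => simp only [TensorProduct.tmul_add, map_add, hs, ht]
    | tmul v y =>
    rw [combineCross_tmul_left, ← hf, combineLeftAux_tmul]
    generalize f' (p ⊗ₜ y) = t
    induction t with
    | zero => simp
    | add s t hs ht => simp only [TensorProduct.tmul_add, map_add, hs, ht]
    | tmul s t => simp [combineRight_tmul]
  · rw [combineRight_tmul]
    generalize f (r ⊗ₜ p) = w
    induction w with
    | zero => simp
    | add s t hs ht => simp only [TensorProduct.add_tmul, map_add, hs, ht]
    | tmul x p =>
    rw [combineCross_tmul_right, hg, combineRightAux_tmul, LinearEquiv.apply_symm_apply]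
    generalize g (x ⊗ₜ v) = t
    induction t with
    | zero => simp
    | add s t hs ht => simp only [TensorProduct.add_tmul, map_add, hs, ht]
    | tmul s t => simp [combineLeft_tmul]

/-- In frame coordinates the spectator factors `Y` and `V` stay inert, and what remains is the axiom
`coassoc`. -/
theorem MultiplierHopfAlgebra.legCommute {A : Type*} [NonUnitalRing A] [Module k A]
    [IsScalarTower k A A] [SMulCommClass k A A] {C : Type*} [AddCommGroup C] [Module k C]
    (H : MultiplierHopfAlgebra k A) (F : (Y ⊗[k] A) ≃ₗ[k] C) (F' : (A ⊗[k] V) ≃ₗ[k] C) :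
    LegCommute (H.rightCov F) (H.leftCov F') := by
  intro r p q
  induction r using F.induction_tmul with
  | h0 => simp
  | ha s t hs ht => simp only [TensorProduct.add_tmul, map_add, hs, ht]
  | ht y a =>
  induction q using F'.induction_tmul with
  | h0 => simp
  | ha s t hs ht => simp only [TensorProduct.tmul_add, map_add, hs, ht]
  | ht c v =>
  rw [H.leftCov_frame, H.rightCov_frame]
  have h := congrArg (TensorProduct.map
    (LinearMap.rTensor A (F.toLinearMap ∘ₗ TensorProduct.mk k Y A y))
    (F'.toLinearMap ∘ₗ (TensorProduct.mk k A V).flip v)) (H.coassoc a p c)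
  simp only [LinearMap.lTensor_tmul, LinearMap.rTensor_tmul, LinearEquiv.coe_coe] at h
  trans
  · refine Eq.trans ?_ h
    generalize H.T₁ (p ⊗ₜ c) = t
    induction t with
    | zero => simp
    | add s t hs ht => simp only [TensorProduct.tmul_add, map_add, hs, ht]
    | tmul s t => simp [H.rightCov_frame]
  · generalize H.T₂ (a ⊗ₜ p) = t
    induction t with
    | zero => simp
    | add s t hs ht => simp only [TensorProduct.add_tmul, map_add, hs, ht]
    | tmul s t =>
      simp only [TensorProduct.assoc_tmul, LinearMap.lTensor_tmul, LinearEquiv.coe_coe,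
        LinearMap.rTensor_tmul, H.leftCov_frame, LinearMap.comp_apply, TensorProduct.mk_apply]
      generalize H.T₁ (t ⊗ₜ c) = t
      induction t with
      | zero => simp
      | add s t hs ht => simp only [TensorProduct.tmul_add, map_add, hs, ht]
      | tmul s t => simp

end Commute

/-! ### The four one-sided actions of `A` and `B` on the twisted product, and associativity. -/

namespace LRTwisted

open TensorProduct (assoc rightComm)

variable {k : Type u} {A : Type v} {B : Type w} [Field k]
  [NonUnitalRing A] [Module k A] [IsScalarTower k A A] [SMulCommClass k A A]
  [NonUnitalRing B] [Module k B] [IsScalarTower k B B] [SMulCommClass k B B]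
  (R : (B ⊗[k] A) ≃ₗ[k] (A ⊗[k] B)) (T : (A ⊗[k] B) ≃ₗ[k] (A ⊗[k] B))

/-- `a ⊗ b ↦ (a # 1)(1 # b)`. -/
def ofAB : (A ⊗[k] B) ≃ₗ[k] LRTwisted R T := T ≪≫ₗ of R T

/-- `b ⊗ a ↦ (1 # b)(a # 1)`. -/
def ofBA : (B ⊗[k] A) ≃ₗ[k] LRTwisted R T := R ≪≫ₗ of R T

/-- Left multiplication by `a # 1`. -/
abbrev lA : A →ₗ[k] Module.End k (LRTwisted R T) := leftAct (ofAB R T)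

/-- Left multiplication by `1 # b`. -/
abbrev lB : B →ₗ[k] Module.End k (LRTwisted R T) := leftAct (ofBA R T)

/-- Right multiplication by `a # 1`. -/
abbrev rA : A →ₗ[k] Module.End k (LRTwisted R T) := rightAct (ofBA R T)

/-- Right multiplication by `1 # b`. -/
abbrev rB : B →ₗ[k] Module.End k (LRTwisted R T) := rightAct (ofAB R T)

theorem ofAB_apply (t : A ⊗[k] B) : ofAB R T t = of R T (T t) := rfl

theorem ofBA_apply (t : B ⊗[k] A) : ofBA R T t = of R T (R t) := rfl

variable {R T}

/-- Translates the action from its own frame to the coordinates of `A ⊗ B`, where it reads `m_A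
T₁₃`; this is the condition `T_mul_left`. The three other actions use the three other product
conditions. -/
theorem lA_of (hRT : IsTwistingPair R T) (a : A) (t : A ⊗[k] B) :
    lA R T a (of R T t) = of R T ((LinearMap.mul' k A).rTensor B
      (leg13 A T ((assoc k A A B).symm (a ⊗ₜ t)))) := by
  obtain ⟨t, rfl⟩ := T.surjective t
  induction t with
  | zero => simp
  | add s t hs ht => simp only [TensorProduct.tmul_add, map_add, hs, ht]
  | tmul c d =>
    have h := LinearMap.congr_fun hRT.T_mul_left ((a ⊗ₜ c) ⊗ₜ d)
    simp only [LinearMap.comp_apply, LinearEquiv.coe_coe, LinearMap.rTensor_tmul,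
      LinearMap.mul'_apply, TensorProduct.assoc_tmul, LinearMap.lTensor_tmul] at h
    rw [← h, ← ofAB_apply, ← ofAB_apply, leftAct_frame]

theorem lA_of_tmul (hRT : IsTwistingPair R T) (a c : A) (d : B) :
    lA R T a (of R T (c ⊗ₜ d)) = of R T ((mulRight k c).rTensor B (T (a ⊗ₜ d))) := by
  rw [lA_of hRT]
  simp only [leg13, LinearMap.comp_apply, LinearEquiv.coe_coe, TensorProduct.rightComm_tmul,
    LinearMap.rTensor_tmul, TensorProduct.assoc_symm_tmul]
  generalize T (a ⊗ₜ d) = t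
  induction t with
  | zero => simp
  | add s t hs ht => simp only [TensorProduct.add_tmul, map_add, hs, ht]
  | tmul s t => simp

theorem rA_of (hRT : IsTwistingPair R T) (a : A) (t : A ⊗[k] B) :
    rA R T a (of R T t) = of R T ((LinearMap.mul' k A).rTensor B
      ((assoc k A A B).symm (R.toLinearMap.lTensor A (assoc k A B A (t ⊗ₜ a))))) := by
  obtain ⟨t, rfl⟩ := R.surjective t
  induction t with
  | zero => simp
  | add s t hs ht => simp only [TensorProduct.add_tmul, map_add, hs, ht]
  | tmul c d =>
    have h := LinearMap.congr_fun hRT.R_mul_right (c ⊗ₜ (d ⊗ₜ a))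
    simp only [LinearMap.comp_apply, LinearEquiv.coe_coe, LinearMap.rTensor_tmul,
      LinearMap.mul'_apply, TensorProduct.assoc_symm_tmul, LinearMap.lTensor_tmul] at h
    rw [← h, ← ofBA_apply, ← ofBA_apply, rightAct_frame]

theorem lB_of (hRT : IsTwistingPair R T) (b : B) (t : A ⊗[k] B) :
    lB R T b (of R T t) = of R T ((LinearMap.mul' k B).lTensor A
      (assoc k A B B (R.toLinearMap.rTensor B ((assoc k B A B).symm (b ⊗ₜ t))))) := by
  obtain ⟨t, rfl⟩ := R.surjective t
  induction t with
  | zero => simp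
  | add s t hs ht => simp only [TensorProduct.tmul_add, map_add, hs, ht]
  | tmul c d =>
    have h := LinearMap.congr_fun hRT.R_mul_left ((b ⊗ₜ c) ⊗ₜ d)
    simp only [LinearMap.comp_apply, LinearEquiv.coe_coe, LinearMap.rTensor_tmul,
      LinearMap.mul'_apply, TensorProduct.assoc_tmul, LinearMap.lTensor_tmul] at h
    rw [← h, ← ofBA_apply, ← ofBA_apply, leftAct_frame]

theorem rB_of (hRT : IsTwistingPair R T) (b : B) (t : A ⊗[k] B) :
    rB R T b (of R T t) = of R T ((LinearMap.mul' k B).lTensor A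
      (assoc k A B B (leg13 B T (t ⊗ₜ b)))) := by
  obtain ⟨t, rfl⟩ := T.surjective t
  induction t with
  | zero => simp
  | add s t hs ht => simp only [TensorProduct.add_tmul, map_add, hs, ht]
  | tmul c d =>
    have h := LinearMap.congr_fun hRT.T_mul_right ((c ⊗ₜ d) ⊗ₜ b)
    simp only [LinearMap.comp_apply, LinearEquiv.coe_coe, LinearMap.rTensor_tmul,
      LinearMap.mul'_apply, TensorProduct.assoc_tmul, LinearMap.lTensor_tmul] at h
    rw [← h, ← ofAB_apply, ← ofAB_apply, rightAct_frame]

/-- Both sides are `(a # 1)(1 # y)(b # 1)`, bracketed differently; in coordinates this is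
`comm_left`. -/
theorem lA_ofBA (hRT : IsTwistingPair R T) (a b : A) (y : B) :
    lA R T a (ofBA R T (y ⊗ₜ b)) = rA R T b (ofAB R T (a ⊗ₜ y)) := by
  have h := LinearMap.congr_fun hRT.comm_left ((a ⊗ₜ y) ⊗ₜ b)
  simp only [LinearMap.comp_apply, LinearEquiv.coe_coe, LinearMap.rTensor_tmul,
    TensorProduct.assoc_tmul, LinearMap.lTensor_tmul] at h
  rw [ofAB_apply, ofBA_apply, lA_of hRT, rA_of hRT, h]

/-- Both sides are `(1 # x)(b # 1)(1 # y)`; in coordinates this is `comm_right`. -/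
theorem lB_ofAB (hRT : IsTwistingPair R T) (x y : B) (b : A) :
    lB R T x (ofAB R T (b ⊗ₜ y)) = rB R T y (ofBA R T (x ⊗ₜ b)) := by
  have h := LinearMap.congr_fun hRT.comm_right ((x ⊗ₜ b) ⊗ₜ y)
  simp only [LinearMap.comp_apply, LinearEquiv.coe_coe, LinearMap.rTensor_tmul,
    TensorProduct.assoc_tmul, LinearMap.lTensor_tmul] at h
  rw [ofAB_apply, ofBA_apply, lB_of hRT, rB_of hRT, h]

theorem lA_rB (a : A) (b : B) (p : LRTwisted R T) :
    lA R T a (rB R T b p) = rB R T b (lA R T a p) := by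
  induction p using (ofAB R T).induction_tmul with
  | h0 => simp
  | ht x y => simp
  | ha s t hs ht => simp only [map_add, hs, ht]

theorem lB_rA (a : A) (b : B) (p : LRTwisted R T) :
    lB R T b (rA R T a p) = rA R T a (lB R T b p) := by
  induction p using (ofBA R T).induction_tmul with
  | h0 => simp
  | ht x y => simp
  | ha s t hs ht => simp only [map_add, hs, ht]

theorem lA_rA (hRT : IsTwistingPair R T) (a c : A) (p : LRTwisted R T) :
    lA R T a (rA R T c p) = rA R T c (lA R T a p) := by
  induction p using (ofBA R T).induction_tmul with
  | h0 => simp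
  | ht y x => rw [rightAct_frame, lA_ofBA hRT, lA_ofBA hRT, rightAct_mul]
  | ha s t hs ht => simp only [map_add, hs, ht]

theorem lB_rB (hRT : IsTwistingPair R T) (b d : B) (p : LRTwisted R T) :
    lB R T b (rB R T d p) = rB R T d (lB R T b p) := by
  induction p using (ofAB R T).induction_tmul with
  | h0 => simp
  | ht y x => rw [rightAct_frame, lB_ofAB hRT, lB_ofAB hRT, rightAct_mul]
  | ha s t hs ht => simp only [map_add, hs, ht]

theorem of_mul_of_tmul (hRT : IsTwistingPair R T) (t : A ⊗[k] B) (c : A) (d : B) :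
    of R T t * of R T (c ⊗ₜ d) = of R T ((LinearMap.mul' k B).lTensor A (assoc k A B B
      (((of R T).symm.conj (rA R T c)).rTensor B (leg13 B T (t ⊗ₜ d))))) := by
  induction t with
  | zero => simp
  | add s t hs ht => simp only [TensorProduct.add_tmul, map_add, add_mul, hs, ht]
  | tmul x y =>
  rw [of_tmul_mul_of_tmul]
  congr 1
  simp only [leg13, LinearMap.comp_apply, LinearEquiv.coe_coe, TensorProduct.rightComm_tmul,
    LinearMap.rTensor_tmul]
  generalize T (x ⊗ₜ d) = t
  induction t with
  | zero => simp
  | add s t hs ht => simp only [TensorProduct.add_tmul, map_add, LinearMap.add_apply, hs, ht]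
  | tmul s t =>
  simp only [TensorProduct.rightComm_tmul, LinearMap.rTensor_tmul, LinearEquiv.conj_apply,
    LinearMap.comp_apply, LinearEquiv.coe_coe, LinearEquiv.symm_symm, rA_of hRT,
    LinearEquiv.symm_apply_apply, TensorProduct.assoc_tmul, LinearMap.lTensor_tmul]
  generalize R (y ⊗ₜ c) = r
  induction r with
  | zero => simp
  | add s t hs ht => simp only [TensorProduct.tmul_add, TensorProduct.add_tmul, map_add, hs, ht]
  | tmul e f => simp [sandwich]

/-- Ties the defining formula of the product to the actions: `comm_right` moves `T₁₃` past `R₁₂`,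
after which the `A` parts meet inside `R`, and the left action of `b` is outermost. -/
theorem ofBA_mul (hRT : IsTwistingPair R T) (b : B) (a : A) (q : LRTwisted R T) :
    ofBA R T (b ⊗ₜ a) * q = lB R T b (lA R T a q) := by
  induction q using (of R T).induction_tmul with
  | h0 => simp
  | ha s t hs ht => simp only [map_add, mul_add, hs, ht]
  | ht c d =>
  have h := LinearMap.congr_fun hRT.comm_right ((b ⊗ₜ a) ⊗ₜ d)
  simp only [LinearMap.comp_apply, LinearEquiv.coe_coe, LinearMap.rTensor_tmul,
    TensorProduct.assoc_tmul, LinearMap.lTensor_tmul] at h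
  rw [ofBA_apply, of_mul_of_tmul hRT, h, lA_of_tmul hRT]
  generalize T (a ⊗ₜ d) = t
  induction t with
  | zero => simp
  | add s t hs ht => simp only [TensorProduct.tmul_add, map_add, hs, ht]
  | tmul s t =>
  have h2 : (of R T).symm.conj (rA R T c) (R (b ⊗ₜ s)) = R (b ⊗ₜ (s * c)) := by
    rw [LinearEquiv.conj_apply]
    exact congrArg (of R T).symm (rightAct_frame (ofBA R T) c s b)
  simp only [LinearMap.rTensor_tmul, LinearMap.mulRight_apply,
    TensorProduct.assoc_symm_tmul, LinearEquiv.coe_coe, h2, lB_of hRT]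

theorem mul_ofBA (hRT : IsTwistingPair R T) (b : B) (a : A) (p : LRTwisted R T) :
    p * ofBA R T (b ⊗ₜ a) = rA R T a (rB R T b p) := by
  induction p using (ofBA R T).induction_tmul with
  | h0 => simp
  | ha s t hs ht => simp only [map_add, add_mul, hs, ht]
  | ht y e => rw [ofBA_mul hRT, lA_ofBA hRT, lB_rA, lB_ofAB hRT]

theorem mul_ofAB (hRT : IsTwistingPair R T) (a : A) (b : B) (p : LRTwisted R T) :
    p * ofAB R T (a ⊗ₜ b) = rB R T b (rA R T a p) := by
  induction p using (ofBA R T).induction_tmul with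
  | h0 => simp
  | ha s t hs ht => simp only [map_add, add_mul, hs, ht]
  | ht y e => rw [ofBA_mul hRT, leftAct_frame, lB_ofAB hRT, rightAct_frame]

theorem ofAB_mul (hRT : IsTwistingPair R T) (a : A) (b : B) (q : LRTwisted R T) :
    ofAB R T (a ⊗ₜ b) * q = lA R T a (lB R T b q) := by
  induction q using (ofBA R T).induction_tmul with
  | h0 => simp
  | ha s t hs ht => simp only [map_add, mul_add, hs, ht]
  | ht y e => rw [mul_ofBA hRT, rightAct_frame, leftAct_frame, lA_ofBA hRT]

/-- With the outer factors in the frame `ofBA`, each bracketing applies two left and two right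
actions to `q`, and left actions commute with right ones. -/
protected theorem mul_assoc (hRT : IsTwistingPair R T) (p q r : LRTwisted R T) :
    p * q * r = p * (q * r) := by
  induction p using (ofBA R T).induction_tmul with
  | h0 => simp
  | ha s t hs ht => simp only [add_mul, hs, ht]
  | ht b a =>
  induction r using (ofBA R T).induction_tmul with
  | h0 => simp
  | ha s t hs ht => simp only [mul_add, hs, ht]
  | ht d c =>
  rw [ofBA_mul hRT, ofBA_mul hRT, mul_ofBA hRT, mul_ofBA hRT, lA_rA hRT, lA_rB, lB_rA, lB_rB hRT]

/-- Reads the product as `a_T · ((1 # x)(c # d_T))`, with `a_T` acting by the product of `A`. Thus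
`x` enters only through its left action, as the integral computation requires. -/
theorem of_tmul_mul (hRT : IsTwistingPair R T) (a c : A) (x d : B) :
    of R T (a ⊗ₜ x) * of R T (c ⊗ₜ d) = TensorProduct.lift ((leftAct (of R T)).compl₂
      (lB R T x ∘ₗ (of R T).toLinearMap ∘ₗ TensorProduct.mk k A B c)) (T (a ⊗ₜ d)) := by
  rw [of_tmul_mul_of_tmul]
  generalize T (a ⊗ₜ d) = t
  induction t with
  | zero => simp
  | add s t hs ht => simp only [map_add, LinearMap.add_apply, hs, ht]
  | tmul s t =>
  simp only [TensorProduct.lift.tmul, LinearMap.compl₂_apply, LinearMap.comp_apply,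
    LinearEquiv.coe_coe, TensorProduct.mk_apply, lB_of hRT, TensorProduct.assoc_symm_tmul,
    LinearMap.rTensor_tmul]
  generalize R (x ⊗ₜ c) = t
  induction t with
  | zero => simp
  | add s t hs ht => simp only [TensorProduct.add_tmul, map_add, hs, ht]
  | tmul s t => simp [sandwich]

/-! ### Non-degeneracy -/

/-- `T * R` is the product with `T ∘ R ∘ τ` applied to its first argument, and that map is
bijective. -/
theorem eq_zero_of_mul (hTR : ∀ p : LRTwisted R T, (∀ q, starTR R T (p ⊗ₜ q) = 0) → p = 0)
    (p : LRTwisted R T) (hp : ∀ q, p * q = 0) : p = 0 := by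
  let e : LRTwisted R T ≃ₗ[k] LRTwisted R T := (of R T).symm ≪≫ₗ TensorProduct.comm k A B ≪≫ₗ
    R ≪≫ₗ T ≪≫ₗ of R T
  have he : e (e.symm p) = p := e.apply_symm_apply p
  have : e.symm p = 0 := hTR _ fun q => by
    refine Eq.trans ?_ (hp q)
    conv_rhs => rw [← he]
    rfl
  rw [← he, this, map_zero]

theorem eq_zero_of_mul' (hRT' : ∀ q : LRTwisted R T, (∀ p, starRT R T (p ⊗ₜ q) = 0) → q = 0)
    (p : LRTwisted R T) (hp : ∀ q, q * p = 0) : p = 0 := by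
  let e : LRTwisted R T ≃ₗ[k] LRTwisted R T := (of R T).symm ≪≫ₗ TensorProduct.comm k A B ≪≫ₗ
    R ≪≫ₗ T ≪≫ₗ of R T
  have he : e (e.symm p) = p := e.apply_symm_apply p
  have : e.symm p = 0 := hRT' _ fun q => by
    refine Eq.trans ?_ (hp q)
    conv_rhs => rw [← he]
    rfl
  rw [← he, this, map_zero]

end LRTwisted

section

open LRTwisted
open TensorProduct (tensorTensorTensorComm)

variable {k : Type u} {A : Type v} {B : Type w} [Field k]
  [NonUnitalRing A] [Module k A] [IsScalarTower k A A] [SMulCommClass k A A]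
  [NonUnitalRing B] [Module k B] [IsScalarTower k B B] [SMulCommClass k B B]
  {R : (B ⊗[k] A) ≃ₗ[k] (A ⊗[k] B)} {T : (A ⊗[k] B) ≃ₗ[k] (A ⊗[k] B)}
  {HA : MultiplierHopfAlgebra k A} {HB : MultiplierHopfAlgebra k B}

/-! ### The multipliers `M # (1 ⊗ 1)` and `(1 ⊗ 1) # N` -/

theorem frameT_tmul (a a' : A) (b b' : B) :
    frameT R T ((a ⊗ₜ a') ⊗ₜ (b ⊗ₜ b')) = ofAB R T (a ⊗ₜ b) ⊗ₜ ofAB R T (a' ⊗ₜ b') := rfl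

theorem frameR_tmul (a a' : A) (b b' : B) :
    frameR R T ((b ⊗ₜ b') ⊗ₜ (a ⊗ₜ a')) = ofBA R T (b ⊗ₜ a) ⊗ₜ ofBA R T (b' ⊗ₜ a') := rfl

/-- In `(1 # t)(m # 1)(n # 1)(1 # s)` the elements `m` and `n` enter only through `mn`. Hence the
multiplier identity for `M # (1 ⊗ 1)` reduces to that for `M`. -/
theorem frameR_mul_frameT (hRT : IsTwistingPair R T) (t s : B ⊗[k] B) (m n : A ⊗[k] A) :
    frameR R T (t ⊗ₜ m) * frameT R T (n ⊗ₜ s) =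
      TensorProduct.homTensorHomMap (RingHom.id k) _ _ _ _
        (TensorProduct.map (lB R T) (lB R T) t) (frameT R T ((m * n) ⊗ₜ s)) := by
  induction t with
  | zero => simp
  | add x y hx hy => simp only [TensorProduct.add_tmul, map_add, add_mul, hx, hy,
      LinearMap.add_apply]
  | tmul t t' =>
  induction s with
  | zero => simp
  | add x y hx hy => simp only [TensorProduct.tmul_add, map_add, mul_add, hx, hy]
  | tmul s s' =>
  induction m with
  | zero => simp
  | add x y hx hy => simp only [TensorProduct.add_tmul, TensorProduct.tmul_add, map_add, add_mul,
      hx, hy]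
  | tmul m m' =>
  induction n with
  | zero => simp
  | add x y hx hy => simp only [TensorProduct.add_tmul, map_add, mul_add, hx, hy]
  | tmul n n' => simp [frameT_tmul, frameR_tmul, ofBA_mul hRT]

theorem frameT_mul_frameR (hRT : IsTwistingPair R T) (t s : A ⊗[k] A) (m n : B ⊗[k] B) :
    frameT R T (t ⊗ₜ m) * frameR R T (n ⊗ₜ s) =
      TensorProduct.homTensorHomMap (RingHom.id k) _ _ _ _
        (TensorProduct.map (lA R T) (lA R T) t) (frameR R T ((m * n) ⊗ₜ s)) := by
  induction t with
  | zero => simp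
  | add x y hx hy => simp only [TensorProduct.add_tmul, map_add, add_mul, hx, hy,
      LinearMap.add_apply]
  | tmul t t' =>
  induction s with
  | zero => simp
  | add x y hx hy => simp only [TensorProduct.tmul_add, map_add, mul_add, hx, hy]
  | tmul s s' =>
  induction m with
  | zero => simp
  | add x y hx hy => simp only [TensorProduct.add_tmul, TensorProduct.tmul_add, map_add, add_mul,
      hx, hy]
  | tmul m m' =>
  induction n with
  | zero => simp
  | add x y hx hy => simp only [TensorProduct.add_tmul, map_add, mul_add, hx, hy]
  | tmul n n' => simp [frameT_tmul, frameR_tmul, ofAB_mul hRT]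

theorem sharpOne_mem (hRT : IsTwistingPair R T) (M : Multiplier k (A ⊗[k] A)) :
    sharpOne R T M ∈ multiplierAlgebra k (LRTwisted R T ⊗[k] LRTwisted R T) := by
  intro p q
  have h : ∀ s t, M.rmul s * t = s * M.lmul t := M.2
  induction p using (frameR R T).induction_tmul with
  | h0 => simp
  | ha x y hx hy => simp only [map_add, add_mul, hx, hy]
  | ht b a =>
  induction q using (frameT R T).induction_tmul with
  | h0 => simp
  | ha x y hx hy => simp only [map_add, mul_add, hx, hy]
  | ht a' b' => simp [sharpOne, LinearEquiv.conj_apply, frameR_mul_frameT hRT, h]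

theorem oneSharp_mem (hRT : IsTwistingPair R T) (N : Multiplier k (B ⊗[k] B)) :
    oneSharp R T N ∈ multiplierAlgebra k (LRTwisted R T ⊗[k] LRTwisted R T) := by
  intro p q
  have h : ∀ s t, N.rmul s * t = s * N.lmul t := N.2
  induction p using (frameT R T).induction_tmul with
  | h0 => simp
  | ha x y hx hy => simp only [map_add, add_mul, hx, hy]
  | ht b a =>
  induction q using (frameR R T).induction_tmul with
  | h0 => simp
  | ha x y hx hy => simp only [map_add, mul_add, hx, hy]
  | ht a' b' => simp [oneSharp, LinearEquiv.conj_apply, frameT_mul_frameR hRT, h]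

theorem sharpOne_add (M N : Multiplier k (A ⊗[k] A)) :
    sharpOne R T (M + N) = sharpOne R T M + sharpOne R T N := by
  have h1 : (M + N).lmul = M.lmul + N.lmul := rfl
  have h2 : (M + N).rmul = M.rmul + N.rmul := rfl
  simp [sharpOne, h1, h2]

theorem sharpOne_smul (c : k) (M : Multiplier k (A ⊗[k] A)) :
    sharpOne R T (c • M) = c • sharpOne R T M := by
  have h1 : (c • M).lmul = c • M.lmul := rfl
  have h2 : (c • M).rmul = c • M.rmul := rfl
  simp [sharpOne, h1, h2]

theorem sharpOne_mul (M N : Multiplier k (A ⊗[k] A)) :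
    sharpOne R T (M * N) = sharpOne R T M * sharpOne R T N := by
  have h1 : (M * N).lmul = M.lmul ∘ₗ N.lmul := rfl
  have h2 : (M * N).rmul = N.rmul ∘ₗ M.rmul := rfl
  simp only [sharpOne, h1, h2, LinearMap.rTensor_comp, LinearMap.lTensor_comp,
    LinearEquiv.conj_comp]
  rfl

theorem oneSharp_add (M N : Multiplier k (B ⊗[k] B)) :
    oneSharp R T (M + N) = oneSharp R T M + oneSharp R T N := by
  have h1 : (M + N).lmul = M.lmul + N.lmul := rfl
  have h2 : (M + N).rmul = M.rmul + N.rmul := rfl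
  simp [oneSharp, h1, h2]

theorem oneSharp_smul (c : k) (M : Multiplier k (B ⊗[k] B)) :
    oneSharp R T (c • M) = c • oneSharp R T M := by
  have h1 : (c • M).lmul = c • M.lmul := rfl
  have h2 : (c • M).rmul = c • M.rmul := rfl
  simp [oneSharp, h1, h2]

theorem oneSharp_mul (M N : Multiplier k (B ⊗[k] B)) :
    oneSharp R T (M * N) = oneSharp R T M * oneSharp R T N := by
  have h1 : (M * N).lmul = M.lmul ∘ₗ N.lmul := rfl
  have h2 : (M * N).rmul = N.rmul ∘ₗ M.rmul := rfl
  simp only [oneSharp, h1, h2, LinearMap.rTensor_comp, LinearMap.lTensor_comp,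
    LinearEquiv.conj_comp]
  rfl

/-! ### Uniqueness of the covered coproducts -/

theorem plainLeft_separates (HA : MultiplierHopfAlgebra k A) (HB : MultiplierHopfAlgebra k B)
    (p : LRTwisted R T) (h : ∀ cz : A × B, plainLeft R T cz.1 cz.2 p = 0) :
    p = 0 := by
  obtain ⟨t, rfl⟩ := (of R T).surjective p
  rw [show t = 0 from ?_, map_zero]
  refine LinearMap.lTensor_jointly_injective (fun z : B => mulLeft k z) HB.mulLeft_separates t
    fun z => ?_
  refine LinearMap.rTensor_jointly_injective (fun z : A => mulLeft k z) HA.mulLeft_separates _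
    fun c => ?_
  rw [← LinearMap.comp_apply, LinearMap.rTensor_comp_lTensor]
  exact h (c, z)

theorem plainRight_separates (HA : MultiplierHopfAlgebra k A) (HB : MultiplierHopfAlgebra k B)
    (p : LRTwisted R T)
    (h : ∀ cz : A × B, plainRight R T cz.1 cz.2 p = 0) : p = 0 := by
  obtain ⟨t, rfl⟩ := (of R T).surjective p
  rw [show t = 0 from ?_, map_zero]
  refine LinearMap.lTensor_jointly_injective (fun z : B => mulRight k z) HB.mulRight_separates t
    fun z => ?_
  refine LinearMap.rTensor_jointly_injective (fun z : A => mulRight k z) HA.mulRight_separates _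
    fun c => ?_
  rw [← LinearMap.comp_apply, LinearMap.rTensor_comp_lTensor]
  exact h (c, z)

theorem IsT₁.unique {p q : LRTwisted R T} {s t : LRTwisted R T ⊗[k] LRTwisted R T}
    (hs : IsT₁ R T HA HB p q s) (ht : IsT₁ R T HA HB p q t) : s = t :=
  LinearMap.rTensor_separates (fun cz : A × B => plainLeft R T cz.1 cz.2)
    (plainLeft_separates HA HB) fun _ => (hs _ _).trans (ht _ _).symm

theorem IsT₂.unique {p q : LRTwisted R T} {s t : LRTwisted R T ⊗[k] LRTwisted R T}
    (hs : IsT₂ R T HA HB q p s) (ht : IsT₂ R T HA HB q p t) : s = t :=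
  LinearMap.lTensor_separates (fun cz : A × B => plainRight R T cz.1 cz.2)
    (plainRight_separates HA HB) fun _ => (hs _ _).trans (ht _ _).symm

theorem IsT₁.zero (q : LRTwisted R T) : IsT₁ R T HA HB 0 q 0 := fun c z => by simp

theorem IsT₂.zero (q : LRTwisted R T) : IsT₂ R T HA HB q 0 0 := fun c z => by simp

theorem IsT₁.add {p p' q : LRTwisted R T} {s t : LRTwisted R T ⊗[k] LRTwisted R T}
    (hs : IsT₁ R T HA HB p q s) (ht : IsT₁ R T HA HB p' q t) :
    IsT₁ R T HA HB (p + p') q (s + t) := fun c z => by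
  rw [map_add, map_add, map_add, hs, ht]

theorem IsT₂.add {p p' q : LRTwisted R T} {s t : LRTwisted R T ⊗[k] LRTwisted R T}
    (hs : IsT₂ R T HA HB q p s) (ht : IsT₂ R T HA HB q p' t) :
    IsT₂ R T HA HB q (p + p') (s + t) := fun c z => by
  rw [map_add, map_add, map_add, hs, ht]

theorem IsComulRT.unique {p : LRTwisted R T} {D D' : PreMultiplier R T}
    (h : IsComulRT R T HA HB p D) (h' : IsComulRT R T HA HB p D') : D = D' := by
  refine Prod.ext (TensorProduct.ext' fun u q => ?_)
    (MulOpposite.unop_injective (TensorProduct.ext' fun q u => ?_))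
  · obtain ⟨s, hs, hs'⟩ := h.left u q
    obtain ⟨t, ht, ht'⟩ := h'.left u q
    rw [hs', ht', hs.unique ht]
  · obtain ⟨s, hs, hs'⟩ := h.right q u
    obtain ⟨t, ht, ht'⟩ := h'.right q u
    rw [hs', ht', hs.unique ht]

theorem IsComulRT.zero : IsComulRT R T HA HB 0 0 where
  left u q := ⟨0, .zero q, by simp⟩
  right q u := ⟨0, .zero q, by simp⟩

theorem IsComulRT.add {p p' : LRTwisted R T} {D D' : PreMultiplier R T}
    (h : IsComulRT R T HA HB p D) (h' : IsComulRT R T HA HB p' D') :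
    IsComulRT R T HA HB (p + p') (D + D') where
  left u q := by
    obtain ⟨s, hs, hs'⟩ := h.left u q
    obtain ⟨t, ht, ht'⟩ := h'.left u q
    refine ⟨s + t, hs.add ht, ?_⟩
    rw [Prod.fst_add, LinearMap.add_apply, hs', ht', map_add]
  right q u := by
    obtain ⟨s, hs, hs'⟩ := h.right q u
    obtain ⟨t, ht, ht'⟩ := h'.right q u
    refine ⟨s + t, hs.add ht, ?_⟩
    rw [Prod.snd_add, MulOpposite.unop_add, LinearMap.add_apply, hs', ht', map_add]

/-! ### The canonical maps -/

variable (R T HA HB)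

/-- `T(a ⊗ x) ⊗ q ↦ ∑ T(a₁ ⊗ x₁) ⊗ T(a₂ ⊗ x₂) q`. -/
def canonicalT₁ : (LRTwisted R T ⊗[k] LRTwisted R T) ≃ₗ[k] (LRTwisted R T ⊗[k] LRTwisted R T) :=
  (ofAB R T).symm.rTensor (LRTwisted R T) ≪≫ₗ
    combineLeft (HA.leftCov (ofAB R T)) (HB.leftCov (ofBA R T)) ≪≫ₗ
    (ofAB R T).rTensor (LRTwisted R T)

/-- `q ⊗ T(a ⊗ x) ↦ ∑ q T(a₁ ⊗ x₁) ⊗ T(a₂ ⊗ x₂)`. -/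
def canonicalT₂ : (LRTwisted R T ⊗[k] LRTwisted R T) ≃ₗ[k] (LRTwisted R T ⊗[k] LRTwisted R T) :=
  (ofAB R T).symm.lTensor (LRTwisted R T) ≪≫ₗ
    combineRight (HA.rightCov (ofBA R T)) (HB.rightCov (ofAB R T)) ≪≫ₗ
    (ofAB R T).lTensor (LRTwisted R T)

variable {R T HA HB}

theorem canonicalT₁_ofAB (t : A ⊗[k] B) (q : LRTwisted R T) :
    canonicalT₁ R T HA HB (ofAB R T t ⊗ₜ q) = (ofAB R T).toLinearMap.rTensor (LRTwisted R T)
      (combineLeft (HA.leftCov (ofAB R T)) (HB.leftCov (ofBA R T)) (t ⊗ₜ q)) := by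
  simp only [canonicalT₁, LinearEquiv.trans_apply, LinearEquiv.rTensor_tmul,
    LinearEquiv.symm_apply_apply]
  rfl

theorem canonicalT₂_ofAB (t : A ⊗[k] B) (q : LRTwisted R T) :
    canonicalT₂ R T HA HB (q ⊗ₜ ofAB R T t) = (ofAB R T).toLinearMap.lTensor (LRTwisted R T)
      (combineRight (HA.rightCov (ofBA R T)) (HB.rightCov (ofAB R T)) (q ⊗ₜ t)) := by
  simp only [canonicalT₂, LinearEquiv.trans_apply, LinearEquiv.lTensor_tmul,
    LinearEquiv.symm_apply_apply]
  rfl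

/-- The factor `(1 ⊗ 1) # Δ(x)` acts first and gives `x₁u ⊗ x₂q`; then `Δ(a) # (1 ⊗ 1)` gives `a₁x₁u
⊗ a₂x₂q`. Splitting off `u` on the right leaves the canonical map. -/
theorem sharpOne_mul_oneSharp_left (hRT : IsTwistingPair R T) (a : A) (x : B)
    (u q : LRTwisted R T) :
    (sharpOne R T (HA.comul a) * oneSharp R T (HB.comul x)).1 (u ⊗ₜ q) =
      (mulRight k u).rTensor (LRTwisted R T) (canonicalT₁ R T HA HB (ofAB R T (a ⊗ₜ x) ⊗ₜ q)) := by
  have hA : ∀ u q, (sharpOne R T (HA.comul a)).1 (u ⊗ₜ q) = _ :=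
    HA.conj_lmul_comul (ofAB R T) a
  have hB : ∀ u q, (oneSharp R T (HB.comul x)).1 (u ⊗ₜ q) = _ :=
    HB.conj_lmul_comul (ofBA R T) x
  rw [Prod.fst_mul, Module.End.mul_apply, hB, canonicalT₁_ofAB, combineLeft_tmul]
  generalize HB.leftCov (ofBA R T) (x ⊗ₜ q) = t
  induction t with
  | zero => simp
  | add s t hs ht => simp only [map_add, hs, ht]
  | tmul x q =>
  rw [LinearMap.rTensor_tmul, hA, combineLeftAux_tmul]
  generalize HA.leftCov (ofAB R T) (a ⊗ₜ q) = t
  induction t with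
  | zero => simp
  | add s t hs ht => simp only [map_add, hs, ht]
  | tmul a q => simp [ofAB_mul hRT]

theorem sharpOne_mul_oneSharp_right (hRT : IsTwistingPair R T) (a : A) (x : B)
    (q u : LRTwisted R T) :
    (sharpOne R T (HA.comul a) * oneSharp R T (HB.comul x)).2.unop (q ⊗ₜ u) =
      (mulLeft k u).lTensor (LRTwisted R T) (canonicalT₂ R T HA HB (q ⊗ₜ ofAB R T (a ⊗ₜ x))) := by
  have hA : ∀ q u, (sharpOne R T (HA.comul a)).2.unop (q ⊗ₜ u) = _ :=
    HA.conj_rmul_comul (ofBA R T) a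
  have hB : ∀ q u, (oneSharp R T (HB.comul x)).2.unop (q ⊗ₜ u) = _ :=
    HB.conj_rmul_comul (ofAB R T) x
  rw [Prod.snd_mul, MulOpposite.unop_mul, Module.End.mul_apply, hA, canonicalT₂_ofAB,
    combineRight_tmul]
  generalize HA.rightCov (ofBA R T) (q ⊗ₜ a) = t
  induction t with
  | zero => simp
  | add s t hs ht => simp only [map_add, hs, ht]
  | tmul q a =>
  rw [LinearMap.lTensor_tmul, hB, combineRightAux_tmul]
  generalize HB.rightCov (ofAB R T) (q ⊗ₜ x) = t
  induction t with
  | zero => simp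
  | add s t hs ht => simp only [map_add, hs, ht]
  | tmul q x => simp [mul_ofAB hRT]

theorem canonicalT₁_coassoc (p q r : LRTwisted R T) :
    (canonicalT₂ R T HA HB).toLinearMap.rTensor (LRTwisted R T)
        ((TensorProduct.assoc k _ _ _).symm
          ((canonicalT₁ R T HA HB).toLinearMap.lTensor (LRTwisted R T) (r ⊗ₜ (p ⊗ₜ q)))) =
      (TensorProduct.assoc k _ _ _).symm
        ((canonicalT₁ R T HA HB).toLinearMap.lTensor (LRTwisted R T)
          (TensorProduct.assoc k _ _ _
            ((canonicalT₂ R T HA HB).toLinearMap.rTensor (LRTwisted R T) ((r ⊗ₜ p) ⊗ₜ q)))) := by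
  obtain ⟨p, rfl⟩ := (ofAB R T).surjective p
  have h := (HA.legCommute (ofBA R T) (ofAB R T)).combine
    (HB.legCommute (ofAB R T) (ofBA R T)) r p q
  have h' := congrArg (((ofAB R T).toLinearMap.lTensor (LRTwisted R T)).rTensor (LRTwisted R T)) h
  simp only [LinearMap.lTensor_tmul, LinearMap.rTensor_tmul, LinearEquiv.coe_coe,
    canonicalT₁_ofAB, canonicalT₂_ofAB]
  trans
  · refine Eq.trans ?_ h'
    generalize combineLeft (HA.leftCov (ofAB R T)) (HB.leftCov (ofBA R T)) (p ⊗ₜ q) = t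
    induction t with
    | zero => simp
    | add s t hs ht => simp only [TensorProduct.tmul_add, map_add, hs, ht]
    | tmul s t => simp [canonicalT₂_ofAB]
  · generalize combineRight (HA.rightCov (ofBA R T)) (HB.rightCov (ofAB R T)) (r ⊗ₜ p) = t
    induction t with
    | zero => simp
    | add s t hs ht => simp only [TensorProduct.add_tmul, map_add, hs, ht]
    | tmul s t =>
      simp only [TensorProduct.assoc_tmul, LinearMap.lTensor_tmul, LinearEquiv.coe_coe,
        canonicalT₁_ofAB]
      generalize combineLeft (HA.leftCov (ofAB R T)) (HB.leftCov (ofBA R T)) (t ⊗ₜ q) = t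
      induction t with
      | zero => simp
      | add s t hs ht => simp only [TensorProduct.tmul_add, map_add, hs, ht]
      | tmul s t => simp

end

section

open LRTwisted
open TensorProduct (tensorTensorTensorComm)

variable {k : Type u} {A : Type v} {B : Type w} [Field k]
  [NonUnitalRing A] [Module k A] [IsScalarTower k A A] [SMulCommClass k A A]
  [NonUnitalRing B] [Module k B] [IsScalarTower k B B] [SMulCommClass k B B]
  {R : (B ⊗[k] A) ≃ₗ[k] (A ⊗[k] B)} {T : (A ⊗[k] B) ≃ₗ[k] (A ⊗[k] B)}
  {HA : MultiplierHopfAlgebra k A} {HB : MultiplierHopfAlgebra k B}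

/-! ### The comultiplication -/

variable (R T HA HB) in
/-- `T(a ⊗ x) ↦ (Δ(a) # (1 ⊗ 1)) ((1 ⊗ 1) # Δ(x))`. -/
def comulRT : LRTwisted R T →ₗ[k] PreMultiplier R T :=
  TensorProduct.lift (LinearMap.mk₂ k
    (fun a x => sharpOne R T (HA.comul a) * oneSharp R T (HB.comul x))
    (fun a a' x => by rw [map_add, sharpOne_add, add_mul])
    (fun c a x => by rw [map_smul, sharpOne_smul, smul_mul_assoc])
    (fun a x x' => by rw [map_add, oneSharp_add, mul_add])
    (fun c a x => by rw [map_smul, oneSharp_smul, mul_smul_comm])) ∘ₗ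
  (ofAB R T).symm.toLinearMap

theorem comulRT_ofAB (a : A) (x : B) : comulRT R T HA HB (ofAB R T (a ⊗ₜ x)) =
    sharpOne R T (HA.comul a) * oneSharp R T (HB.comul x) := by
  simp [comulRT]

theorem comulRT_mem (hRT : IsTwistingPair R T) (p : LRTwisted R T) :
    comulRT R T HA HB p ∈ multiplierAlgebra k (LRTwisted R T ⊗[k] LRTwisted R T) := by
  induction p using (ofAB R T).induction_tmul with
  | h0 => rw [map_zero]; exact zero_mem _
  | ha s t hs ht => rw [map_add]; exact add_mem hs ht
  | ht a x =>
    rw [comulRT_ofAB]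
    exact mul_mem (sharpOne_mem hRT _) (oneSharp_mem hRT _)

theorem comulRT_left (hRT : IsTwistingPair R T) (p u q : LRTwisted R T) :
    (comulRT R T HA HB p).1 (u ⊗ₜ q) =
      (mulRight k u).rTensor (LRTwisted R T) (canonicalT₁ R T HA HB (p ⊗ₜ q)) := by
  induction p using (ofAB R T).induction_tmul with
  | h0 => simp
  | ha s t hs ht => simp only [TensorProduct.add_tmul, map_add, Prod.fst_add,
      LinearMap.add_apply, hs, ht]
  | ht a x => rw [comulRT_ofAB, sharpOne_mul_oneSharp_left hRT]

theorem comulRT_right (hRT : IsTwistingPair R T) (p q u : LRTwisted R T) :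
    (comulRT R T HA HB p).2.unop (q ⊗ₜ u) =
      (mulLeft k u).lTensor (LRTwisted R T) (canonicalT₂ R T HA HB (q ⊗ₜ p)) := by
  induction p using (ofAB R T).induction_tmul with
  | h0 => simp
  | ha s t hs ht => simp only [TensorProduct.tmul_add, map_add, Prod.snd_add,
      MulOpposite.unop_add, LinearMap.add_apply, hs, ht]
  | ht a x => rw [comulRT_ofAB, sharpOne_mul_oneSharp_right hRT]

theorem isComulRT_comulRT
    (hΔT : ∀ (a : A) (x : B), IsComulRT R T HA HB (of R T (T (a ⊗ₜ x)))
      (sharpOne R T (HA.comul a) * oneSharp R T (HB.comul x)))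
    (p : LRTwisted R T) :
    IsComulRT R T HA HB p (comulRT R T HA HB p) := by
  induction p using (ofAB R T).induction_tmul with
  | h0 => rw [map_zero]; exact .zero
  | ha s t hs ht => rw [map_add]; exact hs.add ht
  | ht a x => rw [comulRT_ofAB]; exact hΔT a x

theorem comulRT_mul
    (hΔT : ∀ (a : A) (x : B), IsComulRT R T HA HB (of R T (T (a ⊗ₜ x)))
      (sharpOne R T (HA.comul a) * oneSharp R T (HB.comul x)))
    (hRT : IsTwistingPair R T)
    (hΔR : ∀ (a : A) (x : B), IsComulRT R T HA HB (of R T (R (x ⊗ₜ a)))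
      (oneSharp R T (HB.comul x) * sharpOne R T (HA.comul a))) (p q : LRTwisted R T) :
    comulRT R T HA HB (p * q) = comulRT R T HA HB p * comulRT R T HA HB q := by
  have key : ∀ (a : A) (y : B) (w : LRTwisted R T), comulRT R T HA HB (lA R T a (rB R T y w)) =
      sharpOne R T (HA.comul a) * comulRT R T HA HB w * oneSharp R T (HB.comul y) := by
    intro a y w
    induction w using (ofAB R T).induction_tmul with
    | h0 => simp
    | ha s t hs ht => simp only [map_add, mul_add, add_mul, hs, ht]
    | ht b x =>
      rw [rightAct_frame, leftAct_frame, comulRT_ofAB, comulRT_ofAB, map_mul, map_mul,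
        sharpOne_mul, oneSharp_mul]
      simp only [mul_assoc]
  induction p using (ofAB R T).induction_tmul with
  | h0 => simp
  | ha s t hs ht => simp only [map_add, add_mul, hs, ht]
  | ht a x =>
  induction q using (ofAB R T).induction_tmul with
  | h0 => simp
  | ha s t hs ht => simp only [map_add, mul_add, hs, ht]
  | ht b y =>
  -- The inner factor is `R(x ⊗ b)`. By uniqueness of the coproduct multiplier, its value prescribed
  -- through `T` agrees with the one prescribed through `R`.
  rw [ofAB_mul hRT, lB_ofAB hRT, key, ofBA_apply, (isComulRT_comulRT hΔT _).unique (hΔR b x),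
    comulRT_ofAB, comulRT_ofAB]
  simp only [mul_assoc]

/-- `IsComulRT` supplies a covered coproduct `t` for each `u`, but `t` is unique and so independent
of `u`. It agrees with the canonical map after multiplication by every `u ⊗ 1`, and non-degeneracy
cancels `u`. -/
theorem isT₁_canonicalT₁
    (hΔT : ∀ (a : A) (x : B), IsComulRT R T HA HB (of R T (T (a ⊗ₜ x)))
      (sharpOne R T (HA.comul a) * oneSharp R T (HB.comul x)))
    (hRT : IsTwistingPair R T)
    (hTR : ∀ p : LRTwisted R T, (∀ q, starTR R T (p ⊗ₜ q) = 0) → p = 0) (p q : LRTwisted R T) :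
    IsT₁ R T HA HB p q (canonicalT₁ R T HA HB (p ⊗ₜ q)) := by
  have h := (isComulRT_comulRT hΔT p).left
  -- Only the existence of `t` is taken here, so any value of `u`, such as `0`, serves.
  obtain ⟨t, ht, -⟩ := h 0 q
  rw [show canonicalT₁ R T HA HB (p ⊗ₜ q) = t from ?_]
  · exact ht
  refine LinearMap.rTensor_separates (fun u : LRTwisted R T => mulRight k u)
    (eq_zero_of_mul hTR) fun u => ?_
  obtain ⟨t', ht', h'⟩ := h u q
  rw [← comulRT_left hRT, h', ht'.unique ht]

theorem isT₂_canonicalT₂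
    (hΔT : ∀ (a : A) (x : B), IsComulRT R T HA HB (of R T (T (a ⊗ₜ x)))
      (sharpOne R T (HA.comul a) * oneSharp R T (HB.comul x)))
    (hRT : IsTwistingPair R T)
    (hRT' : ∀ q : LRTwisted R T, (∀ p, starRT R T (p ⊗ₜ q) = 0) → q = 0) (p q : LRTwisted R T) :
    IsT₂ R T HA HB q p (canonicalT₂ R T HA HB (q ⊗ₜ p)) := by
  have h := (isComulRT_comulRT hΔT p).right
  obtain ⟨t, ht, -⟩ := h q 0
  rw [show canonicalT₂ R T HA HB (q ⊗ₜ p) = t from ?_]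
  · exact ht
  refine LinearMap.lTensor_separates (fun u : LRTwisted R T => mulLeft k u)
    (eq_zero_of_mul' hRT') fun u => ?_
  obtain ⟨t', ht', h'⟩ := h q u
  rw [← comulRT_right hRT, h', ht'.unique ht]

theorem IsT₁.mulRight (hRT : IsTwistingPair R T) {p q : LRTwisted R T}
    {t : LRTwisted R T ⊗[k] LRTwisted R T} (ht : IsT₁ R T HA HB p q t) (u : LRTwisted R T) :
    IsT₁ R T HA HB p (q * u) ((LinearMap.mulRight k u).lTensor (LRTwisted R T) t) := fun c z => by
  have h : LinearMap.mulRight k (q * u) = LinearMap.mulRight k u ∘ₗ LinearMap.mulRight k q :=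
    LinearMap.ext fun r => (LRTwisted.mul_assoc hRT r q u).symm
  rw [h, LinearMap.lTensor_comp, LinearMap.comp_apply, ← ht c z, ← LinearMap.comp_apply,
    ← LinearMap.comp_apply, LinearMap.rTensor_comp_lTensor, LinearMap.lTensor_comp_rTensor]

theorem IsT₂.mulLeft (hRT : IsTwistingPair R T) {p q : LRTwisted R T}
    {t : LRTwisted R T ⊗[k] LRTwisted R T} (ht : IsT₂ R T HA HB q p t) (u : LRTwisted R T) :
    IsT₂ R T HA HB (u * q) p ((LinearMap.mulLeft k u).rTensor (LRTwisted R T) t) := fun c z => by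
  have h : LinearMap.mulLeft k (u * q) = LinearMap.mulLeft k u ∘ₗ LinearMap.mulLeft k q :=
    LinearMap.ext fun r => LRTwisted.mul_assoc hRT u q r
  rw [h, LinearMap.rTensor_comp, LinearMap.comp_apply, ← ht c z, ← LinearMap.comp_apply,
    ← LinearMap.comp_apply, LinearMap.rTensor_comp_lTensor, LinearMap.lTensor_comp_rTensor]

/-! ### Counit and right integral -/

theorem coverLeft_of_tmul (c a : A) (z x : B) :
    coverLeft R T HA HB c z (of R T (a ⊗ₜ x)) =
      TensorProduct.map (of R T).toLinearMap (of R T).toLinearMap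
        (tensorTensorTensorComm k A A B B (HA.T₂ (c ⊗ₜ a) ⊗ₜ HB.T₂ (z ⊗ₜ x))) := rfl

theorem coverRight_of_tmul (c a : A) (z x : B) :
    coverRight R T HA HB c z (of R T (a ⊗ₜ x)) =
      TensorProduct.map (of R T).toLinearMap (of R T).toLinearMap
        (tensorTensorTensorComm k A A B B (HA.T₁ (a ⊗ₜ c) ⊗ₜ HB.T₁ (x ⊗ₜ z))) := rfl

theorem tensorFunctional_of_tmul (f : A →ₗ[k] k) (g : B →ₗ[k] k) (a : A) (x : B) :
    tensorFunctional R T f g (of R T (a ⊗ₜ x)) = f a * g x := by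
  simp [tensorFunctional]

theorem lid_tensorFunctional_map (f : A →ₗ[k] k) (g : B →ₗ[k] k) (s : A ⊗[k] A) (t : B ⊗[k] B) :
    TensorProduct.lid k (LRTwisted R T) ((tensorFunctional R T f g).rTensor (LRTwisted R T)
      (TensorProduct.map (of R T).toLinearMap (of R T).toLinearMap
        (tensorTensorTensorComm k A A B B (s ⊗ₜ t)))) =
      of R T (TensorProduct.lid k A (f.rTensor A s) ⊗ₜ TensorProduct.lid k B (g.rTensor B t)) := by
  induction s with
  | zero => simp
  | add x y hx hy => simp only [TensorProduct.add_tmul, map_add, hx, hy]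
  | tmul a a' =>
  induction t with
  | zero => simp
  | add x y hx hy => simp only [TensorProduct.tmul_add, map_add, hx, hy]
  | tmul x x' =>
    simp [tensorFunctional_of_tmul, TensorProduct.smul_tmul_smul, - TensorProduct.tmul_smul]

theorem rid_tensorFunctional_map (f : A →ₗ[k] k) (g : B →ₗ[k] k) (s : A ⊗[k] A) (t : B ⊗[k] B) :
    TensorProduct.rid k (LRTwisted R T) ((tensorFunctional R T f g).lTensor (LRTwisted R T)
      (TensorProduct.map (of R T).toLinearMap (of R T).toLinearMap
        (tensorTensorTensorComm k A A B B (s ⊗ₜ t)))) =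
      of R T (TensorProduct.rid k A (f.lTensor A s) ⊗ₜ TensorProduct.rid k B (g.lTensor B t)) := by
  induction s with
  | zero => simp
  | add x y hx hy => simp only [TensorProduct.add_tmul, map_add, hx, hy]
  | tmul a a' =>
  induction t with
  | zero => simp
  | add x y hx hy => simp only [TensorProduct.tmul_add, map_add, hx, hy]
  | tmul x x' =>
    simp [tensorFunctional_of_tmul, TensorProduct.smul_tmul_smul, - TensorProduct.tmul_smul]

theorem LRTwisted.subsingleton_or {k : Type*} {A B : Type*} [Field k] [NonUnitalRing A] [Module k A]
    [NonUnitalRing B] [Module k B] (R : (B ⊗[k] A) ≃ₗ[k] (A ⊗[k] B))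
    (T : (A ⊗[k] B) ≃ₗ[k] (A ⊗[k] B)) :
    Subsingleton (LRTwisted R T) ∨ (Nontrivial A ∧ Nontrivial B) := by
  rcases subsingleton_or_nontrivial A with hA | hA
  · exact .inl (inferInstanceAs (Subsingleton (A ⊗[k] B)))
  rcases subsingleton_or_nontrivial B with hB | hB
  · exact .inl (inferInstanceAs (Subsingleton (A ⊗[k] B)))
  exact .inr ⟨hA, hB⟩

/-- Cover the first legs by `c` and `z` of counit one. As `ε_A` and `ε_B` are multiplicative,
`ε_{RT}` does not see this covering, and on the covered coproduct it is computed factor by factor.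
-/
theorem IsT₁.counit {εA : A →ₗ[k] k} (hεA : HA.IsCounit εA) {εB : B →ₗ[k] k}
    (hεB : HB.IsCounit εB) {p q : LRTwisted R T} {t : LRTwisted R T ⊗[k] LRTwisted R T}
    (ht : IsT₁ R T HA HB p q t) : TensorProduct.lid k (LRTwisted R T)
      ((tensorFunctional R T εA εB).rTensor (LRTwisted R T) t) = p * q := by
  rcases LRTwisted.subsingleton_or R T with h | ⟨hA, hB⟩
  · exact Subsingleton.elim _ _
  obtain ⟨c, hc⟩ := hεA.exists_eq_one
  obtain ⟨z, hz⟩ := hεB.exists_eq_one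
  have h1 : tensorFunctional R T εA εB ∘ₗ plainLeft R T c z = tensorFunctional R T εA εB := by
    ext s
    induction s using (of R T).induction_tmul with
    | h0 => simp
    | ha s t hs ht => simp only [map_add, hs, ht]
    | ht a x => simp [plainLeft, LinearEquiv.conj_apply, tensorFunctional_of_tmul,
        hεA.apply_mul, hεB.apply_mul, hc, hz]
  have h2 := congrArg (fun s => TensorProduct.lid k (LRTwisted R T)
    ((tensorFunctional R T εA εB).rTensor (LRTwisted R T) s)) (ht c z)
  simp only [← LinearMap.comp_apply, ← LinearMap.rTensor_comp, h1] at h2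
  simp only [LinearMap.comp_apply] at h2
  rw [h2]
  have h3 : ∀ s : LRTwisted R T ⊗[k] LRTwisted R T, TensorProduct.lid k (LRTwisted R T)
      ((tensorFunctional R T εA εB).rTensor (LRTwisted R T)
        ((LinearMap.mulRight k q).lTensor (LRTwisted R T) s)) =
      TensorProduct.lid k (LRTwisted R T)
        ((tensorFunctional R T εA εB).rTensor (LRTwisted R T) s) * q := by
    intro s
    induction s with
    | zero => simp
    | tmul x y => simp [smul_mul_assoc]
    | add x y hx hy => simp only [map_add, add_mul, hx, hy]
  rw [h3]
  congr 1
  clear h2 ht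
  induction p using (of R T).induction_tmul with
  | h0 => simp
  | ha s t hs ht => simp only [map_add, hs, ht]
  | ht a x => rw [coverLeft_of_tmul, lid_tensorFunctional_map, hεA.rTensor_T₂, hεB.rTensor_T₂,
      hc, hz, one_smul, one_smul]

theorem IsT₂.counit {εA : A →ₗ[k] k} (hεA : HA.IsCounit εA) {εB : B →ₗ[k] k}
    (hεB : HB.IsCounit εB) {p q : LRTwisted R T} {t : LRTwisted R T ⊗[k] LRTwisted R T}
    (ht : IsT₂ R T HA HB q p t) : TensorProduct.rid k (LRTwisted R T)
      ((tensorFunctional R T εA εB).lTensor (LRTwisted R T) t) = q * p := by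
  rcases LRTwisted.subsingleton_or R T with h | ⟨hA, hB⟩
  · exact Subsingleton.elim _ _
  obtain ⟨c, hc⟩ := hεA.exists_eq_one
  obtain ⟨z, hz⟩ := hεB.exists_eq_one
  have h1 : tensorFunctional R T εA εB ∘ₗ plainRight R T c z = tensorFunctional R T εA εB := by
    ext s
    induction s using (of R T).induction_tmul with
    | h0 => simp
    | ha s t hs ht => simp only [map_add, hs, ht]
    | ht a x => simp [plainRight, LinearEquiv.conj_apply, tensorFunctional_of_tmul,
        hεA.apply_mul, hεB.apply_mul, hc, hz]
  have h2 := congrArg (fun s => TensorProduct.rid k (LRTwisted R T)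
    ((tensorFunctional R T εA εB).lTensor (LRTwisted R T) s)) (ht c z)
  simp only [← LinearMap.comp_apply, ← LinearMap.lTensor_comp, h1] at h2
  simp only [LinearMap.comp_apply] at h2
  rw [h2]
  have h3 : ∀ s : LRTwisted R T ⊗[k] LRTwisted R T, TensorProduct.rid k (LRTwisted R T)
      ((tensorFunctional R T εA εB).lTensor (LRTwisted R T)
        ((LinearMap.mulLeft k q).rTensor (LRTwisted R T) s)) =
      q * TensorProduct.rid k (LRTwisted R T)
        ((tensorFunctional R T εA εB).lTensor (LRTwisted R T) s) := by
    intro s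
    induction s with
    | zero => simp
    | tmul x y => simp [mul_smul_comm]
    | add x y hx hy => simp only [map_add, mul_add, hx, hy]
  rw [h3]
  congr 1
  clear h2 ht
  induction p using (of R T).induction_tmul with
  | h0 => simp
  | ha s t hs ht => simp only [map_add, hs, ht]
  | ht a x => rw [coverRight_of_tmul, rid_tensorFunctional_map, hεA.lTensor_T₁, hεB.lTensor_T₁,
      hc, hz, one_smul, one_smul]

variable (HB) in
/-- `a ⊗ d ↦ ∑ x₁ ⊗ (a · 1) (x₂ (c ⊗ d))`, where `a` acts by the product of `A`. -/
def stepCov (x : B) (c : A) : (A ⊗[k] B) →ₗ[k] (B ⊗[k] LRTwisted R T) :=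
  TensorProduct.lift ((LinearMap.lTensorHom B ∘ₗ leftAct (of R T)).compl₂
    ((HB.leftCov (ofBA R T)).toLinearMap ∘ₗ TensorProduct.mk k B (LRTwisted R T) x ∘ₗ
      (of R T).toLinearMap ∘ₗ TensorProduct.mk k A B c))

variable (R T) in
/-- `a ⊗ d ↦ (y ↦ (a · 1) (y (c ⊗ d)))`, where `a` acts by the product of `A`. -/
def stepAct (c : A) : (A ⊗[k] B) →ₗ[k] (B →ₗ[k] LRTwisted R T) :=
  TensorProduct.lift ((LinearMap.llcomp k B (LRTwisted R T) (LRTwisted R T) ∘ₗ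
    leftAct (of R T)).compl₂ ((lB R T).flip ∘ₗ (of R T).toLinearMap ∘ₗ TensorProduct.mk k A B c))

theorem stepCov_tmul (x : B) (c a : A) (d : B) :
    stepCov HB x c (a ⊗ₜ d) = (leftAct (of R T) a).lTensor B
      (HB.leftCov (ofBA R T) (x ⊗ₜ of R T (c ⊗ₜ d))) := rfl

theorem stepAct_tmul (c a : A) (d : B) :
    stepAct R T c (a ⊗ₜ d) = leftAct (of R T) a ∘ₗ (lB R T).flip (of R T (c ⊗ₜ d)) := rfl

theorem stepAct_apply (hRT : IsTwistingPair R T) (a c : A) (y d : B) :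
    stepAct R T c (T (a ⊗ₜ d)) y = of R T (a ⊗ₜ y) * of R T (c ⊗ₜ d) := by
  rw [of_tmul_mul hRT]
  generalize T (a ⊗ₜ d) = t
  induction t with
  | zero => simp
  | add s t hs ht => simp only [map_add, LinearMap.add_apply, hs, ht]
  | tmul s t => rfl

theorem mulLeft_stepCov (z x : B) (c : A) (w : A ⊗[k] B) :
    (LinearMap.mulLeft k z).rTensor (LRTwisted R T) (stepCov HB x c w) =
      (stepAct R T c w).lTensor B (HB.T₂ (z ⊗ₜ x)) := by
  induction w with
  | zero => simp
  | add s t hs ht => simp only [map_add, LinearMap.lTensor_add, LinearMap.add_apply, hs, ht]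
  | tmul a d =>
    rw [stepCov_tmul, stepAct_tmul, LinearMap.lTensor_comp, LinearMap.comp_apply,
      ← HB.mulLeft_leftCov, ← LinearMap.comp_apply, ← LinearMap.comp_apply,
      LinearMap.rTensor_comp_lTensor, LinearMap.lTensor_comp_rTensor]

theorem rTensor_stepCov (hRT : IsTwistingPair R T) {ψB : B →ₗ[k] k} (hψB : HB.IsRightIntegral ψB)
    (x d : B) (a c : A) :
    TensorProduct.lid k (LRTwisted R T) (ψB.rTensor (LRTwisted R T)
      (stepCov HB x c (T (a ⊗ₜ d)))) = ψB x • lA R T a (of R T (c ⊗ₜ d)) := by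
  rw [lA_of_tmul hRT]
  generalize T (a ⊗ₜ d) = t
  induction t with
  | zero => simp
  | add s t hs ht => simp only [map_add, smul_add, hs, ht]
  | tmul a d =>
    have h : ∀ s : B ⊗[k] LRTwisted R T, TensorProduct.lid k (LRTwisted R T)
        (ψB.rTensor (LRTwisted R T) ((leftAct (of R T) a).lTensor B s)) =
        leftAct (of R T) a (TensorProduct.lid k (LRTwisted R T)
          (ψB.rTensor (LRTwisted R T) s)) := by
      intro s
      induction s with
      | zero => simp
      | add s t hs ht => simp only [map_add, hs, ht]
      | tmul s t => simp
    rw [stepCov_tmul, h, hψB.rTensor_leftCov, map_smul, leftAct_frame, LinearMap.rTensor_tmul,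
      LinearMap.mulRight_apply]

/-- The leg `x₁` needs no cover from the left: since `(a₂ # x₂)(c # d)` lets `x₂` act on `c # d_T`,
the sum `x₁ ⊗ x₂(c # d_T)` already lies in `B ⊗ LRTwisted R T`. Only `a₁` stays covered, by `c'`. -/
theorem IsT₁.mulLeft_rTensor (hRT : IsTwistingPair R T) {a c : A} {x d : B}
    {t : LRTwisted R T ⊗[k] LRTwisted R T}
    (ht : IsT₁ R T HA HB (of R T (a ⊗ₜ x)) (of R T (c ⊗ₜ d)) t) (c' : A) :
    (LinearMap.mulLeft k c').rTensor (B ⊗[k] LRTwisted R T)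
      (TensorProduct.assoc k A B (LRTwisted R T)
        ((of R T).symm.toLinearMap.rTensor (LRTwisted R T) t)) =
      (stepCov HB x c ∘ₗ T.toLinearMap ∘ₗ (TensorProduct.mk k A B).flip d).lTensor A
        (HA.T₂ (c' ⊗ₜ a)) := by
  refine LinearMap.lTensor_separates
    (fun z : B => (LinearMap.mulLeft k z).rTensor (LRTwisted R T)) (fun v hv =>
      LinearMap.rTensor_jointly_injective (fun z : B => LinearMap.mulLeft k z)
        HB.mulLeft_separates v hv) fun z => ?_
  have h1 : ∀ t : LRTwisted R T ⊗[k] LRTwisted R T,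
      ((LinearMap.mulLeft k z).rTensor (LRTwisted R T)).lTensor A
        ((LinearMap.mulLeft k c').rTensor (B ⊗[k] LRTwisted R T)
          (TensorProduct.assoc k A B (LRTwisted R T)
            ((of R T).symm.toLinearMap.rTensor (LRTwisted R T) t))) =
      TensorProduct.assoc k A B (LRTwisted R T)
        ((of R T).symm.toLinearMap.rTensor (LRTwisted R T)
          ((plainLeft R T c' z).rTensor (LRTwisted R T) t)) := by
    intro t
    induction t with
    | zero => simp
    | add s t hs ht => simp only [map_add, hs, ht]
    | tmul p q =>
    induction p using (of R T).induction_tmul with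
    | h0 => simp
    | ha s t hs ht => simp only [TensorProduct.add_tmul, map_add, hs, ht]
    | ht a x => simp [plainLeft, LinearEquiv.conj_apply]
  rw [h1, ht c' z, coverLeft_of_tmul, ← LinearMap.comp_apply (LinearMap.lTensor A _),
    ← LinearMap.lTensor_comp]
  generalize HA.T₂ (c' ⊗ₜ a) = s
  induction s with
  | zero => simp
  | add s t hs ht => simp only [TensorProduct.add_tmul, map_add, hs, ht]
  | tmul s a =>
  simp only [LinearMap.lTensor_tmul, LinearMap.comp_apply, LinearMap.flip_apply,
    TensorProduct.mk_apply, LinearEquiv.coe_coe, mulLeft_stepCov]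
  generalize HB.T₂ (z ⊗ₜ x) = r
  induction r with
  | zero => simp
  | add s t hs ht => simp only [TensorProduct.tmul_add, map_add, hs, ht]
  | tmul r y => simp [stepAct_apply hRT]

/-- Integrate over `B` first: `x₁ ⊗ x₂(c # d_T)` becomes `ψ_B(x)(c # d_T)`, leaving `ψ_B(x) a₁ ⊗
(a₂)_T c # d_T`. The second leg is `(a₂ # 1)(c # d)`, so the invariance of `ψ_A` applies to the
action of `A`. -/
theorem IsT₁.rightIntegral (hRT : IsTwistingPair R T) {ψA : A →ₗ[k] k}
    (hψA : HA.IsRightIntegral ψA) {ψB : B →ₗ[k] k} (hψB : HB.IsRightIntegral ψB) {a c : A}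
    {x d : B} {t : LRTwisted R T ⊗[k] LRTwisted R T}
    (ht : IsT₁ R T HA HB (of R T (a ⊗ₜ x)) (of R T (c ⊗ₜ d)) t) :
    TensorProduct.lid k (LRTwisted R T)
      ((tensorFunctional R T ψA ψB).rTensor (LRTwisted R T) t) =
        (ψA a * ψB x) • of R T (c ⊗ₜ d) := by
  let ψ : (B ⊗[k] LRTwisted R T) →ₗ[k] LRTwisted R T :=
    (TensorProduct.lid k (LRTwisted R T)).toLinearMap ∘ₗ ψB.rTensor (LRTwisted R T)
  have h1 : ∀ t : LRTwisted R T ⊗[k] LRTwisted R T, TensorProduct.lid k (LRTwisted R T)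
      ((tensorFunctional R T ψA ψB).rTensor (LRTwisted R T) t) =
      TensorProduct.lid k (LRTwisted R T) (ψA.rTensor (LRTwisted R T)
        (ψ.lTensor A (TensorProduct.assoc k A B (LRTwisted R T)
          ((of R T).symm.toLinearMap.rTensor (LRTwisted R T) t)))) := by
    intro t
    induction t with
    | zero => simp
    | add s t hs ht => simp only [map_add, hs, ht]
    | tmul p q =>
    induction p using (of R T).induction_tmul with
    | h0 => simp
    | ha s t hs ht => simp only [TensorProduct.add_tmul, map_add, hs, ht]
    | ht a x => simp [ψ, tensorFunctional_of_tmul, smul_smul, mul_comm]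
  have h2 : ψ.lTensor A (TensorProduct.assoc k A B (LRTwisted R T)
      ((of R T).symm.toLinearMap.rTensor (LRTwisted R T) t)) =
      ψB x • HA.leftCov (ofAB R T) (a ⊗ₜ of R T (c ⊗ₜ d)) := by
    refine LinearMap.rTensor_separates (fun c : A => LinearMap.mulLeft k c)
      HA.mulLeft_separates fun c' => ?_
    have h3 : ψ ∘ₗ stepCov HB x c ∘ₗ T.toLinearMap ∘ₗ (TensorProduct.mk k A B).flip d =
        ψB x • (lA R T).flip (of R T (c ⊗ₜ d)) :=
      LinearMap.ext fun a => rTensor_stepCov hRT hψB x d a c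
    rw [← LinearMap.comp_apply, LinearMap.rTensor_comp_lTensor, ← LinearMap.lTensor_comp_rTensor,
      LinearMap.comp_apply, ht.mulLeft_rTensor hRT, ← LinearMap.comp_apply,
      ← LinearMap.lTensor_comp, h3, LinearMap.lTensor_smul, map_smul, HA.mulLeft_leftCov,
      LinearMap.smul_apply]
  rw [h1, h2, map_smul, map_smul, hψA.rTensor_leftCov, smul_smul, mul_comm]

theorem rightIntegral_canonicalT₁ (hRT : IsTwistingPair R T)
    (hT₁ : ∀ p q : LRTwisted R T, IsT₁ R T HA HB p q (canonicalT₁ R T HA HB (p ⊗ₜ q)))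
    {ψA : A →ₗ[k] k} (hψA : HA.IsRightIntegral ψA) {ψB : B →ₗ[k] k}
    (hψB : HB.IsRightIntegral ψB) (p q : LRTwisted R T) :
    TensorProduct.lid k (LRTwisted R T) ((tensorFunctional R T ψA ψB).rTensor (LRTwisted R T)
      (canonicalT₁ R T HA HB (p ⊗ₜ q))) = tensorFunctional R T ψA ψB p • q := by
  induction p using (of R T).induction_tmul with
  | h0 => simp
  | ha s t hs ht => simp only [TensorProduct.add_tmul, map_add, add_smul, hs, ht]
  | ht a x =>
  induction q using (of R T).induction_tmul with
  | h0 => simp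
  | ha s t hs ht => simp only [TensorProduct.tmul_add, map_add, smul_add, hs, ht]
  | ht c d => rw [(hT₁ _ _).rightIntegral hRT hψA hψB, tensorFunctional_of_tmul]

/-! ### The antipode -/

/-- By naturality of the flip, `S_{RT}` is `T ∘ R ∘ τ` after `S_A ⊗ S_B`. The first factor is the
one built into `T * R` and `R * T`, which makes the antipode identities literal instances of the
hypotheses. -/
theorem antipodeRT_eq (SA : A →ₗ[k] A) (SB : B →ₗ[k] B) (p : LRTwisted R T) :
    antipodeRT R T SA SB p = flipTR R T (plainAntipode R T SA SB p) := by
  induction p using (of R T).induction_tmul with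
  | h0 => simp
  | ha s t hs ht => simp only [map_add, hs, ht]
  | ht a x => simp [antipodeRT, flipTR, plainAntipode, LinearEquiv.conj_apply]

theorem mul'_antipodeRT_rTensor (SA : A →ₗ[k] A) (SB : B →ₗ[k] B)
    (t : LRTwisted R T ⊗[k] LRTwisted R T) :
    LinearMap.mul' k (LRTwisted R T) ((antipodeRT R T SA SB).rTensor (LRTwisted R T) t) =
      starTR R T ((plainAntipode R T SA SB).rTensor (LRTwisted R T) t) := by
  induction t with
  | zero => simp
  | add s t hs ht => simp only [map_add, hs, ht]
  | tmul p q =>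
    rw [LinearMap.rTensor_tmul, LinearMap.mul'_apply, antipodeRT_eq]
    rfl

theorem mul'_antipodeRT_lTensor (SA : A →ₗ[k] A) (SB : B →ₗ[k] B)
    (t : LRTwisted R T ⊗[k] LRTwisted R T) :
    LinearMap.mul' k (LRTwisted R T) ((antipodeRT R T SA SB).lTensor (LRTwisted R T) t) =
      starRT R T ((plainAntipode R T SA SB).lTensor (LRTwisted R T) t) := by
  induction t with
  | zero => simp
  | add s t hs ht => simp only [map_add, hs, ht]
  | tmul p q =>
    rw [LinearMap.lTensor_tmul, LinearMap.mul'_apply, antipodeRT_eq]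
    rfl

theorem tensorFunctional_ne_zero {f : A →ₗ[k] k} (hf : f ≠ 0) {g : B →ₗ[k] k} (hg : g ≠ 0) :
    tensorFunctional R T f g ≠ 0 := by
  obtain ⟨a, ha⟩ := DFunLike.ne_iff.1 hf
  obtain ⟨x, hx⟩ := DFunLike.ne_iff.1 hg
  intro h
  have := LinearMap.congr_fun h (of R T (a ⊗ₜ x))
  rw [tensorFunctional_of_tmul] at this
  exact mul_ne_zero ha hx this

end

/-! ### Assembling the multiplier Hopf algebra. -/

theorem proposition2p1p14
    {k : Type u} {A : Type v} {B : Type w} [Field k]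
    [NonUnitalRing A] [Module k A] [IsScalarTower k A A] [SMulCommClass k A A]
    [NonUnitalRing B] [Module k B] [IsScalarTower k B B] [SMulCommClass k B B]
    -- the multiplier Hopf algebras `A` and `B`, with counits and antipodes
    (HA : MultiplierHopfAlgebra k A) (HB : MultiplierHopfAlgebra k B)
    (εA : A →ₗ[k] k) (hεA : HA.IsCounit εA) (SA : A →ₗ[k] A) (hSA : HA.IsAntipode εA SA)
    (εB : B →ₗ[k] k) (hεB : HB.IsCounit εB) (SB : B →ₗ[k] B) (hSB : HB.IsAntipode εB SB)
    -- the bijective twisting maps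
    (R : (B ⊗[k] A) ≃ₗ[k] (A ⊗[k] B)) (T : (A ⊗[k] B) ≃ₗ[k] (A ⊗[k] B))
    (hRT : IsTwistingPair R T)
    -- non-degeneracy of `T * R` and `R * T`
    (hTR : ∀ p : LRTwisted R T, (∀ q, starTR R T (p ⊗ₜ q) = 0) → p = 0)
    (hRT' : ∀ q : LRTwisted R T, (∀ p, starRT R T (p ⊗ₜ q) = 0) → q = 0)
    -- `Δ_{RT}(R(x ⊗ a)) = ((1 ⊗ 1) # Δ_B(x)) (Δ_A(a) # (1 ⊗ 1))`
    (hΔR : ∀ (a : A) (x : B), IsComulRT R T HA HB (LRTwisted.of R T (R (x ⊗ₜ a)))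
      (oneSharp R T (HB.comul x) * sharpOne R T (HA.comul a)))
    -- `Δ_{RT} ∘ T = (T ⊗ T) ∘ Δ_{RT}`, where `T(a ⊗ x) = (a # 1)(1 # x)`
    (hΔT : ∀ (a : A) (x : B), IsComulRT R T HA HB (LRTwisted.of R T (T (a ⊗ₜ x)))
      (sharpOne R T (HA.comul a) * oneSharp R T (HB.comul x)))
    -- `(T * R) ∘ (S_A ⊗ S_B ⊗ id) ∘ Δ_{RT} = (1 # 1) ε_{RT}`
    (hSTR : ∀ (p q : LRTwisted R T) (t : LRTwisted R T ⊗[k] LRTwisted R T),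
      IsT₁ R T HA HB p q t →
        starTR R T ((plainAntipode R T SA SB).rTensor (LRTwisted R T) t) =
          tensorFunctional R T εA εB p • q)
    -- `(R * T) ∘ (id ⊗ S_A ⊗ S_B) ∘ Δ_{RT} = (1 # 1) ε_{RT}`
    (hSRT : ∀ (q p : LRTwisted R T) (t : LRTwisted R T ⊗[k] LRTwisted R T),
      IsT₂ R T HA HB q p t →
        starRT R T ((plainAntipode R T SA SB).lTensor (LRTwisted R T) t) =
          tensorFunctional R T εA εB p • q)
    -- right integrals on `A` and `B`
    (ψA : A →ₗ[k] k) (hψA : HA.IsRightIntegral ψA)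
    (ψB : B →ₗ[k] k) (hψB : HB.IsRightIntegral ψB) :
    ∃ H : MultiplierHopfAlgebra k (LRTwisted R T),
      (∀ p, IsComulRT R T HA HB p (H.comul p).1) ∧
      H.IsCounit (tensorFunctional R T εA εB) ∧
      H.IsAntipode (tensorFunctional R T εA εB) (antipodeRT R T SA SB) ∧
      H.IsRightIntegral (tensorFunctional R T ψA ψB) := by
  have hT₁ := isT₁_canonicalT₁ hΔT hRT hTR
  have hT₂ := isT₂_canonicalT₂ hΔT hRT hRT'
  refine ⟨{
    assoc := LRTwisted.mul_assoc hRT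
    nondegenerate_left := LRTwisted.eq_zero_of_mul hTR
    nondegenerate_right := LRTwisted.eq_zero_of_mul' hRT'
    comul :=
      { toFun := fun p => ⟨comulRT R T HA HB p, comulRT_mem hRT p⟩
        map_smul' := fun c p => Subtype.ext (map_smul _ c p)
        map_zero' := Subtype.ext (map_zero _)
        map_add' := fun p q => Subtype.ext (map_add _ p q)
        map_mul' := fun p q => Subtype.ext (comulRT_mul hΔT hRT hΔR p q) }
    T₁ := canonicalT₁ R T HA HB
    T₂ := canonicalT₂ R T HA HB
    T₁_spec := fun p q u => by
      change (comulRT R T HA HB p).1 _ = _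
      induction u with
      | zero => simp
      | add s t hs ht => simp only [map_add, mul_add, hs, ht]
      | tmul u u' =>
        -- Uniqueness of covered coproducts gives `T₁(p ⊗ qu') = T₁(p ⊗ q)(1 ⊗ u')`, so the
        -- canonical map is right linear in its second argument.
        rw [LinearMap.lTensor_tmul, LinearMap.mulLeft_apply, comulRT_left hRT,
          (hT₁ p (q * u')).unique ((hT₁ p q).mulRight hRT u'), tensor_mul_tmul]
    T₂_spec := fun q p u => by
      change (comulRT R T HA HB p).2.unop _ = _
      induction u with
      | zero => simp
      | add s t hs ht => simp only [map_add, add_mul, hs, ht]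
      | tmul u u' =>
        rw [LinearMap.rTensor_tmul, LinearMap.mulRight_apply, comulRT_right hRT,
          (hT₂ p (u * q)).unique ((hT₂ p q).mulLeft hRT u), tmul_mul_tensor,
          ← LinearMap.comp_apply, ← LinearMap.comp_apply, LinearMap.rTensor_comp_lTensor,
          LinearMap.lTensor_comp_rTensor]
    coassoc := fun r p q => canonicalT₁_coassoc p q r }, isComulRT_comulRT hΔT,
    ⟨fun p q => (hT₁ p q).counit hεA hεB, fun q p => (hT₂ p q).counit hεA hεB⟩,
    ⟨fun p q => (mul'_antipodeRT_rTensor SA SB _).trans (hSTR p q _ (hT₁ p q)),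
      fun q p => (mul'_antipodeRT_lTensor SA SB _).trans (hSRT q p _ (hT₂ p q))⟩,
    ⟨tensorFunctional_ne_zero hψA.ne_zero hψB.ne_zero,
      rightIntegral_canonicalT₁ hRT hT₁ hψA hψB⟩⟩

end
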